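/- Let $n\ge 1$ and let $-\mathcal L$ generate a bounded analytic semigroup $\{e^{-z\mathcal L}\}$ on $L^2(\mathbb R^n)$ (complex-valued functions, some sector $|\arg z|<\theta$, $0<\theta\le\pi/2$) such that, for $t>0$, $e^{-t\mathcal L}$ is given by a kernel $\mathcal P_t(x,y)$, jointly measurable in $(t,x,y)$, with the Gaussian bound $|\mathcal P_t(x,y)|\le C_0t^{-n/2}e^{-A|x-y|^2/t}$ for all $t>0$ and $x,y\in\mathbb R^n$, where $C_0,A>0$ are constants. For functions $f$ outside $L^2$ put $e^{-t\mathcal L}f(x)=\int_{\mathbb R^n}\mathcal P_t(x,y)f(y)\,dy$. For $0<\alpha<n$ and $s>0$ put $$\mathcal L^{-\alpha/2}f(x)=\frac1{\Gamma(\alpha/2)}\int_0^\infty e^{-t\mathcal L}f(x)\,t^{\alpha/2-1}dt,$$ $$D_sf(x)=\frac1{\Gamma(\alpha/2)}\int_0^\infty\big(e^{-t\mathcal L}f(x)-e^{-(t+s)\mathcal L}f(x)\big)t^{\alpha/2-1}dt,$$ $$G_f(x)=\frac1{\Gamma(\alpha/2)}\int_0^\infty\!\int_{\mathbb R^n}|\mathcal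 P_t(x,y)||f(y)|\,dy\,t^{\alpha/2-1}dt\in[0,\infty].$$ ($D_s$ is the operator $(I-e^{-s\mathcal L})\mathcal L^{-\alpha/2}$.) Let $\mathcal M$ be the class of locally integrable $g$ with $\int_{\mathbb R^n}|g(x)|^2(1+|x|)^{-n-\varrho}dx<\infty$ for some $\varrho>0$. Let $\mathrm{BMO}_{\mathcal L}$ be the set of $g\in\mathcal M$ with $$\|g\|_{\mathrm{BMO}_{\mathcal L}}:=\operatorname*{ess\,sup}_{x}\ \sup_{B\ni x}\frac1{m(B)}\int_B|g(y)-e^{-r_B^2\mathcal L}g(y)|\,dy<\infty,$$ where $B$ runs over the open balls containing $x$ and $r_B$ is the radius of $B$. Finally let $\|f\|_{L^{p,\infty}}=\sup_{\lambda>0}\lambda\, m(\{|f|>\lambda\})^{1/p}$, and let $L^{p,\infty}(\mathbb R^n)$ be the set of measurable $f$ for which this is finite. Let $0<\alpha<n$ and $p=n/\alpha$. Then there is a constant $C>0$ such that the following hold for every $f\in L^{p,\infty}(\mathbb R^n)$. 1. For every $s>0$ the integral defining $D_sf(x)$ converges absolutely for almost every $x$, and $$\operatorname*{ess\,sup}_{x}\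 \sup_{B\ni x}\frac1{m(B)}\int_B|D_{r_B^2}f(y)|\,dy\le C\|f\|_{L^{p,\infty}}.$$ 2. If the Riesz potential $\mathcal I_\alpha(|f|)$ is finite almost everywhere, then $\int_{\mathbb R^n}G_f(x)^2(1+|x|)^{-n-\varrho}dx<\infty$ for some $\varrho>0$. 3. If $\int_{\mathbb R^n}G_f(x)^2(1+|x|)^{-n-\varrho}dx<\infty$ for some $\varrho>0$, then $D_sf=\mathcal L^{-\alpha/2}f-e^{-s\mathcal L}(\mathcal L^{-\alpha/2}f)$ almost everywhere for every $s>0$, $\mathcal L^{-\alpha/2}f\in\mathrm{BMO}_{\mathcal L}$, and $$\|\mathcal L^{-\alpha/2}f\|_{\mathrm{BMO}_{\mathcal L}}\le C\|f\|_{L^{p,\infty}}.$$ -/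

import Mathlib

open MeasureTheory Set Filter Topology
open scoped ENNReal NNReal

noncomputable section

/-- The space `ℝⁿ` with its Euclidean norm and Lebesgue measure. -/
abbrev Rn (n : ℕ) : Type := EuclideanSpace ℝ (Fin n)

/-- The complex Hilbert space `L²(ℝⁿ)`. -/
abbrev L2 (n : ℕ) : Type := Lp ℂ 2 (volume : Measure (Rn n))

/-- The open sector of half-angle `θ` around the positive real axis. -/
def sector (θ : ℝ) : Set ℂ := {z | z ≠ 0 ∧ |z.arg| < θ}

/-- `S` is a bounded analytic semigroup of angle `θ ∈ (0, π/2]` on the Banach space `H`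
(for `z` in the sector, `S z` stands for `e^{-zL}`). -/
structure IsBoundedAnalyticSemigroup {H : Type*} [NormedAddCommGroup H] [NormedSpace ℂ H]
    (θ : ℝ) (S : ℂ → H →L[ℂ] H) : Prop where
  angle_pos : 0 < θ
  angle_le : θ ≤ Real.pi / 2
  map_add : ∀ z ∈ sector θ, ∀ w ∈ sector θ, S (z + w) = (S z).comp (S w)
  holomorphic : DifferentiableOn ℂ S (sector θ)
  bounded : ∀ θ' : ℝ, 0 < θ' → θ' < θ → ∃ M : ℝ, ∀ z ∈ sector θ', ‖S z‖ ≤ M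
  tendsto_zero : ∀ θ' : ℝ, 0 < θ' → θ' < θ → ∀ u : H,
    Tendsto (fun z => S z u) (𝓝[sector θ'] 0) (𝓝 u)

/-- `-L` is the infinitesimal generator of `t ↦ S t = e^{-tL}`: the domain of `L` consists of the
`u` for which `(u - S t u) / t` converges as `t → 0⁺`, and `L u` is the limit. -/
structure IsGenerator {H : Type*} [NormedAddCommGroup H] [NormedSpace ℂ H]
    (L : H →ₗ.[ℂ] H) (S : ℂ → H →L[ℂ] H) : Prop where
  mem_domain_iff : ∀ u : H, u ∈ L.domain ↔
    ∃ v : H, Tendsto (fun t : ℝ => ((t : ℂ)⁻¹) • (u - S (t : ℂ) u)) (𝓝[>] 0) (𝓝 v)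
  tendsto : ∀ u : L.domain,
    Tendsto (fun t : ℝ => ((t : ℂ)⁻¹) • ((u : H) - S (t : ℂ) (u : H))) (𝓝[>] 0) (𝓝 (L u))

/-- For `t > 0` the operator `S t` on `L²(ℝⁿ)` is the integral operator with kernel `P t`, and the
(jointly measurable) kernel has a Gaussian upper bound. -/
structure HasGaussianKernel {n : ℕ} (S : ℂ → L2 n →L[ℂ] L2 n)
    (P : ℝ → Rn n → Rn n → ℂ) : Prop where
  measurable : Measurable fun q : ℝ × Rn n × Rn n => P q.1 q.2.1 q.2.2
  gaussian_bound : ∃ C A : ℝ, 0 < C ∧ 0 < A ∧ ∀ t : ℝ, 0 < t → ∀ x y : Rn n,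
    ‖P t x y‖ ≤ C / t ^ ((n : ℝ) / 2) * Real.exp (-(A * ‖x - y‖ ^ 2 / t))
  represents : ∀ t : ℝ, 0 < t → ∀ u : L2 n,
    (S (t : ℂ) u : Rn n → ℂ) =ᵐ[volume] fun x => ∫ y, P t x y * u y

/-- The action `e^{-tL} f (x) = ∫ P_t(x,y) f(y) dy` on functions beyond `L²`. -/
def heat {n : ℕ} (P : ℝ → Rn n → Rn n → ℂ) (t : ℝ) (f : Rn n → ℂ) (x : Rn n) : ℂ :=
  ∫ y, P t x y * f y

/-- The generalized fractional integral
`L^{-α/2} f (x) = Γ(α/2)⁻¹ ∫₀^∞ e^{-tL} f (x) t^{α/2-1} dt`. -/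
def fracIntegral {n : ℕ} (P : ℝ → Rn n → Rn n → ℂ) (α : ℝ) (f : Rn n → ℂ) (x : Rn n) : ℂ :=
  ((Real.Gamma (α / 2))⁻¹ : ℝ) *
    ∫ t in Ioi (0 : ℝ), heat P t f x * ((t ^ (α / 2 - 1) : ℝ) : ℂ)

/-- The operator of absolute values that dominates `L^{-α/2}`:
`Γ(α/2)⁻¹ ∫₀^∞ ∫ |P_t(x,y)| |f(y)| dy t^{α/2-1} dt`, with values in `[0, ∞]`. -/
def absFracIntegral {n : ℕ} (P : ℝ → Rn n → Rn n → ℂ) (α : ℝ) (f : Rn n → ℂ) (x : Rn n) : ℝ≥0∞ :=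
  ENNReal.ofReal (Real.Gamma (α / 2))⁻¹ *
    ∫⁻ t in Ioi (0 : ℝ), (∫⁻ y, ‖P t x y‖ₑ * ‖f y‖ₑ) * ENNReal.ofReal (t ^ (α / 2 - 1))

/-- The integrand, in `t`, of the difference operator `(I - e^{-sL}) L^{-α/2} f (x)`. -/
def diffIntegrand {n : ℕ} (P : ℝ → Rn n → Rn n → ℂ) (α s : ℝ) (f : Rn n → ℂ) (x : Rn n)
    (t : ℝ) : ℂ :=
  (heat P t f x - heat P (t + s) f x) * ((t ^ (α / 2 - 1) : ℝ) : ℂ)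

/-- The difference operator `(I - e^{-sL}) L^{-α/2}`:
`Γ(α/2)⁻¹ ∫₀^∞ (e^{-tL} f (x) - e^{-(t+s)L} f (x)) t^{α/2-1} dt`. -/
def diffFracIntegral {n : ℕ} (P : ℝ → Rn n → Rn n → ℂ) (α s : ℝ) (f : Rn n → ℂ) (x : Rn n) : ℂ :=
  ((Real.Gamma (α / 2))⁻¹ : ℝ) * ∫ t in Ioi (0 : ℝ), diffIntegrand P α s f x t

/-- The Riesz potential `I_α` of a nonnegative function, with values in `[0, ∞]`. -/
def rieszPotential {n : ℕ} (α : ℝ) (F : Rn n → ℝ≥0∞) (x : Rn n) : ℝ≥0∞ :=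
  ENNReal.ofReal (Real.Gamma (((n : ℝ) - α) / 2) /
      (2 ^ α * Real.pi ^ ((n : ℝ) / 2) * Real.Gamma (α / 2))) *
    ∫⁻ y, F y / ENNReal.ofReal (‖x - y‖ ^ ((n : ℝ) - α))

/-- The weak Lebesgue quasi-norm `sup_{l > 0} l · m({|f| > l})^{1/p}`. -/
def weakNorm {n : ℕ} (p : ℝ) (f : Rn n → ℂ) : ℝ≥0∞ :=
  ⨆ l : ℝ≥0, (l : ℝ≥0∞) * (volume {x | (l : ℝ≥0∞) < ‖f x‖ₑ}) ^ (1 / p)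

/-- Membership in the weak Lebesgue space `L^{p,∞}(ℝⁿ)`. -/
def MemWeakLp {n : ℕ} (p : ℝ) (f : Rn n → ℂ) : Prop :=
  AEStronglyMeasurable f volume ∧ weakNorm p f < ∞

/-- The weighted norm `(∫ F(x)² (1+|x|)^{-(n+ρ)} dx)^{1/2}`, with values in `[0, ∞]`. -/
def typeNorm {n : ℕ} (ρ : ℝ) (F : Rn n → ℝ≥0∞) : ℝ≥0∞ :=
  (∫⁻ x, F x ^ 2 / ENNReal.ofReal ((1 + ‖x‖) ^ ((n : ℝ) + ρ))) ^ (1 / 2 : ℝ)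

/-- The class `𝓜` of locally integrable functions of `ρ`-type for some `ρ > 0`
(a Gaussian decays faster than every power, so there is no upper limit on `ρ`). -/
def MemType {n : ℕ} (g : Rn n → ℂ) : Prop :=
  LocallyIntegrable g volume ∧ ∃ ρ : ℝ, 0 < ρ ∧ typeNorm ρ (fun x => ‖g x‖ₑ) < ∞

/-- For a family `D s`, `s > 0`, of functions, the supremum over the balls `B ∋ x` of
`m(B)⁻¹ ∫_B |D_{r_B²}(y)| dy`, where `r_B` is the radius of `B`. -/
def sharpMaximal {n : ℕ} (D : ℝ → Rn n → ℂ) (x : Rn n) : ℝ≥0∞ :=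
  ⨆ (c : Rn n) (r : ℝ) (_ : 0 < r) (_ : x ∈ Metric.ball c r),
    ⨍⁻ y in Metric.ball c r, ‖D (r ^ 2) y‖ₑ ∂volume

/-- `‖M^#_L g‖_{L^∞}`, where `M^#_L` is the sharp maximal function of the semigroup. -/
def bmoNorm {n : ℕ} (P : ℝ → Rn n → Rn n → ℂ) (g : Rn n → ℂ) : ℝ≥0∞ :=
  essSup (sharpMaximal fun s y => g y - heat P s g y) volume

/-- Membership in `BMO_L(ℝⁿ)`. -/
def MemBMO {n : ℕ} (P : ℝ → Rn n → Rn n → ℂ) (g : Rn n → ℂ) : Prop :=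
  MemType g ∧ bmoNorm P g < ∞

end

/-! ### Power integrals and weak Lebesgue functions -/

section Estimates

/-! Let `N` bound the weak norm of `f`. Since `p = n/α > 1`, cutting `f` at a height `l` leaves a
bounded part and an integrable part of norm `≲ l (N/l)^p`. Everything rests on choosing `l` well.
With a Gaussian weight and `l = t^(-α/2) N` one gets `|e^{-tL} f| ≲ t^(-α/2) N`. With the indicator
of a ball one gets `∫_B |f| ≲ r^(n-α) N`; averaging over translates gives the same bound for
`e^{-tL} f`, uniformly in `t` (`exists_heatAbs_le`, `exists_lintegral_ball_heatAbs_le`).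

Decay for `t > s` comes from analyticity alone, with no regularity of the kernel. The Cauchy
estimate gives `‖e^{-tL} - e^{-(t+s)L}‖ ≲ s/t` on `L²`. Placed between the Gaussian bounds `L¹ → L²`
and `L² → L^∞` it becomes `(s/t) t^(-n/2)` from `L¹` to `L^∞`, and a cut of `f` at the balancing
height gives `(s/t)^(α/n) t^(-α/2) N` on weak `L^p` (`exists_enorm_heat_sub_le`). Against
`t^(α/2-1)` this is integrable on `(s, ∞)`. For `t ≤ s` no cancellation is needed. Hence the
integral of `|D_s f|` over a ball of radius `r` is `≲ (r^(n-α) s^(α/2) + r^n) N`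
(`exists_lintegral_ball_diffIntegrand_le`), of the order of the volume when `s = r²`. This is the
sharp maximal bound.

For the Riesz potential criterion, the times `t ≤ r²` have `L²` mass `≲ r^n N²` on a ball of radius
`r`, by one sup bound times one ball bound. For `t > r²` a Gaussian of width `√t` hardly notices a
move of length `2r`, so this part is controlled by the Riesz potential at one fixed point. Growth
`r^n` of the local `L²` mass gives type `ρ = 2`.

The identity for `D_s` is Fubini together with the semigroup law on weak `L^p`, which is carried
over from `L²` by truncation. It turns the sharp maximal bound into the `BMO_L` bound. -/

theorem lintegral_Ioi_rpow {a c : ℝ} (ha : a < -1) (hc : 0 < c) :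
    ∫⁻ t in Ioi c, ENNReal.ofReal (t ^ a) = ENNReal.ofReal (c ^ (a + 1) / (-(a + 1))) := by
  rw [← ofReal_integral_eq_lintegral_ofReal (integrableOn_Ioi_rpow_of_lt ha hc),
    integral_Ioi_rpow_of_lt ha hc]
  · congr 1
    rw [div_neg, neg_div]
  · filter_upwards [ae_restrict_mem measurableSet_Ioi] with t ht
    exact Real.rpow_nonneg (hc.le.trans (le_of_lt ht)) _

theorem lintegral_Ioc_rpow {a c : ℝ} (ha : -1 < a) (hc : 0 < c) :
    ∫⁻ t in Ioc 0 c, ENNReal.ofReal (t ^ a) = ENNReal.ofReal (c ^ (a + 1) / (a + 1)) := by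
  have hi : IntegrableOn (fun t : ℝ => t ^ a) (Ioc 0 c) := by
    rw [← intervalIntegrable_iff_integrableOn_Ioc_of_le hc.le]
    exact intervalIntegral.intervalIntegrable_rpow' ha
  rw [← ofReal_integral_eq_lintegral_ofReal hi, ← intervalIntegral.integral_of_le hc.le,
    integral_rpow (Or.inl ha)]
  · rw [Real.zero_rpow (by linarith), sub_zero]
  · filter_upwards [ae_restrict_mem measurableSet_Ioc] with t ht
    exact Real.rpow_nonneg ht.1.le _

variable {n : ℕ}

/-- The distribution function of a function in weak `L^p`. -/
theorem volume_lt_le_of_weakNorm_le {p N l : ℝ} {f : Rn n → ℂ} (hp : 0 < p) (hN : 0 < N)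
    (hf : weakNorm p f ≤ ENNReal.ofReal N) (hl : 0 < l) :
    volume {x | l < ‖f x‖} ≤ ENNReal.ofReal ((N / l) ^ p) := by
  have h1 : ENNReal.ofReal l * (volume {x | l < ‖f x‖}) ^ (1 / p) ≤ ENNReal.ofReal N := by
    refine le_trans ?_ hf
    have := le_iSup (fun l : ℝ≥0 =>
      (l : ℝ≥0∞) * (volume {x | (l : ℝ≥0∞) < ‖f x‖ₑ}) ^ (1 / p)) l.toNNReal
    refine le_trans (le_of_eq ?_) this
    have hs : {x | l < ‖f x‖} = {x | ((l.toNNReal : ℝ≥0) : ℝ≥0∞) < ‖f x‖ₑ} := by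
      ext x
      simp only [mem_ofPred_eq, ← ofReal_norm]
      exact (ENNReal.ofReal_lt_ofReal_iff_of_nonneg hl.le).symm
    rw [hs]
    rfl
  have h2 : (volume {x | l < ‖f x‖}) ^ (1 / p) ≤ ENNReal.ofReal (N / l) := by
    rw [ENNReal.ofReal_div_of_pos hl, ENNReal.le_div_iff_mul_le
      (Or.inl (by simpa using hl)) (Or.inl ENNReal.ofReal_ne_top), mul_comm]
    exact h1
  have h3 := ENNReal.rpow_le_rpow h2 hp.le
  rwa [← ENNReal.rpow_mul, one_div_mul_cancel hp.ne', ENNReal.rpow_one,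
    ENNReal.ofReal_rpow_of_nonneg (by positivity) hp.le] at h3

/-- The integral of a weak `L^p` function over the set where it is large. -/
theorem lintegral_large_le {p N l : ℝ} {f : Rn n → ℂ} (hp : 1 < p) (hN : 0 < N)
    (hfm : Measurable f) (hf : weakNorm p f ≤ ENNReal.ofReal N) (hl : 0 < l) :
    ∫⁻ y, ‖{x | l < ‖f x‖}.indicator f y‖ₑ ≤
      ENNReal.ofReal (p / (p - 1) * l * (N / l) ^ p) := by
  have hp0 : 0 < p := by linarith
  have hE : MeasurableSet {x | l < ‖f x‖} := measurableSet_lt measurable_const hfm.norm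
  have hlc := lintegral_eq_lintegral_meas_lt (volume : Measure (Rn n))
    (f := fun y => ‖{x | l < ‖f x‖}.indicator f y‖)
    (Eventually.of_forall fun _ => norm_nonneg _) (hfm.indicator hE).norm.aemeasurable
  simp only [ofReal_norm] at hlc
  rw [hlc, ← Ioc_union_Ioi_eq_Ioi hl.le,
    lintegral_union measurableSet_Ioi (Ioc_disjoint_Ioi le_rfl)]
  -- Layer cake: below height `l` the distribution function of the cut function is at most its value
  -- for `f` at `l`; above `l` it is bounded by that of `f`.
  have hsub : ∀ t : ℝ, 0 < t → {a | t < ‖{x | l < ‖f x‖}.indicator f a‖} ⊆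
      {x | max l t < ‖f x‖} := by
    intro t ht a ha
    simp only [mem_ofPred_eq] at ha ⊢
    by_cases h : a ∈ {x | l < ‖f x‖}
    · rw [indicator_of_mem h] at ha
      exact max_lt h ha
    · rw [indicator_of_notMem h, norm_zero] at ha
      linarith
  have h1 : ∫⁻ t in Ioc 0 l, volume {a | t < ‖{x | l < ‖f x‖}.indicator f a‖} ≤
      ENNReal.ofReal (l * (N / l) ^ p) := by
    calc _ ≤ ∫⁻ t in Ioc 0 l, ENNReal.ofReal ((N / l) ^ p) := by
          refine setLIntegral_mono measurable_const fun t ht => ?_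
          refine (measure_mono (hsub t ht.1)).trans ?_
          rw [max_eq_left ht.2]
          exact volume_lt_le_of_weakNorm_le hp0 hN hf hl
      _ = _ := by
          rw [setLIntegral_const, Real.volume_Ioc, sub_zero, mul_comm,
            ← ENNReal.ofReal_mul hl.le]
  have h2 : ∫⁻ t in Ioi l, volume {a | t < ‖{x | l < ‖f x‖}.indicator f a‖} ≤
      ENNReal.ofReal (l * (N / l) ^ p / (p - 1)) := by
    calc _ ≤ ∫⁻ t in Ioi l, ENNReal.ofReal (N ^ p) * ENNReal.ofReal (t ^ (-p)) := by
          refine setLIntegral_mono (by fun_prop) fun t ht => ?_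
          have ht0 : 0 < t := hl.trans ht
          refine (measure_mono (hsub t ht0)).trans ?_
          rw [max_eq_right (le_of_lt ht), ← ENNReal.ofReal_mul (by positivity)]
          refine (volume_lt_le_of_weakNorm_le hp0 hN hf ht0).trans (le_of_eq ?_)
          rw [Real.div_rpow hN.le ht0.le, Real.rpow_neg ht0.le, div_eq_mul_inv]
      _ = _ := by
          rw [lintegral_const_mul _ (by fun_prop), lintegral_Ioi_rpow (by linarith) hl,
            ← ENNReal.ofReal_mul (by positivity)]
          congr 1
          rw [Real.div_rpow hN.le hl.le, show -p + 1 = 1 - p by ring, Real.rpow_sub hl,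
            Real.rpow_one]
          have : p - 1 ≠ 0 := by linarith
          have := (Real.rpow_pos_of_pos hl p).ne'
          have : -(1 - p) = p - 1 := by ring
          rw [this]
          field_simp
  refine (add_le_add h1 h2).trans (le_of_eq ?_)
  have hp1 : 0 < p - 1 := by linarith
  rw [← ENNReal.ofReal_add (by positivity) (by positivity)]
  congr 1
  field_simp
  ring

/-- A bounded integrable weight against a weak `L^p` function. -/
theorem lintegral_mul_le_of_weakNorm_le {p N l a b : ℝ} {f : Rn n → ℂ} (hp : 1 < p) (hN : 0 < N)
    (hfm : Measurable f) (hf : weakNorm p f ≤ ENNReal.ofReal N) (hl : 0 < l)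
    (ha0 : 0 ≤ a) (hb0 : 0 ≤ b) {w : Rn n → ℝ≥0∞} (hw : Measurable w)
    (ha : ∫⁻ y, w y ≤ ENNReal.ofReal a) (hb : ∀ y, w y ≤ ENNReal.ofReal b) :
    ∫⁻ y, w y * ‖f y‖ₑ ≤ ENNReal.ofReal (l * a + b * (p / (p - 1) * l * (N / l) ^ p)) := by
  have hp1 : 0 < p - 1 := by linarith
  have hE : MeasurableSet {x | l < ‖f x‖} := measurableSet_lt measurable_const hfm.norm
  calc ∫⁻ y, w y * ‖f y‖ₑ
      ≤ ∫⁻ y, (ENNReal.ofReal l * w y +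
          ENNReal.ofReal b * ‖{x | l < ‖f x‖}.indicator f y‖ₑ) := by
        refine lintegral_mono fun y => ?_
        by_cases h : y ∈ {x | l < ‖f x‖}
        · rw [indicator_of_mem h]
          exact le_add_left (mul_le_mul_left (hb y) _)
        · rw [indicator_of_notMem h, enorm_zero, mul_zero, add_zero, mul_comm]
          refine mul_le_mul_left ?_ _
          rw [← ofReal_norm]
          exact ENNReal.ofReal_le_ofReal (not_lt.1 h)
    _ = ENNReal.ofReal l * (∫⁻ y, w y) +
          ENNReal.ofReal b * ∫⁻ y, ‖{x | l < ‖f x‖}.indicator f y‖ₑ := by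
        rw [lintegral_add_left (hw.const_mul _), lintegral_const_mul _ hw,
          lintegral_const_mul _ (hfm.indicator hE).enorm]
    _ ≤ ENNReal.ofReal l * ENNReal.ofReal a +
          ENNReal.ofReal b * ENNReal.ofReal (p / (p - 1) * l * (N / l) ^ p) := by
        gcongr
        exact lintegral_large_le hp hN hfm hf hl
    _ = _ := by
        rw [← ENNReal.ofReal_mul hl.le, ← ENNReal.ofReal_mul hb0,
          ← ENNReal.ofReal_add (by positivity) (by positivity)]

/-- The average growth of a weak `L^{n/α}` function on balls. -/
theorem lintegral_ball_le {α N r : ℝ} {f : Rn n → ℂ} (hα : 0 < α) (hαn : α < n) (hN : 0 < N)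
    (hfm : Measurable f) (hf : weakNorm (n / α) f ≤ ENNReal.ofReal N) (hr : 0 < r) (c : Rn n) :
    ∫⁻ y in Metric.ball c r, ‖f y‖ₑ ≤
      ENNReal.ofReal (((volume (Metric.ball (0 : Rn n) 1)).toReal + (n / α) / (n / α - 1)) *
        r ^ ((n : ℝ) - α) * N) := by
  have hn : 0 < (n : ℝ) := hα.trans hαn
  have hp : 1 < n / α := by rwa [one_lt_div hα]
  have hp1 : 0 < n / α - 1 := by linarith
  -- The balancing height: `(N/l)^(n/α) = r^n`, so both terms of the splitting are of order `r^(n-α)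
  -- N`.
  have hl : 0 < r ^ (-α) * N := by positivity
  have hv : volume (Metric.ball c r) =
      ENNReal.ofReal (r ^ (n : ℝ) * (volume (Metric.ball (0 : Rn n) 1)).toReal) := by
    rw [Measure.addHaar_ball_of_pos _ _ hr, ENNReal.ofReal_mul (by positivity),
      ENNReal.ofReal_toReal measure_ball_lt_top.ne, finrank_euclideanSpace_fin, Real.rpow_natCast]
  have key := lintegral_mul_le_of_weakNorm_le (a := r ^ (n : ℝ) *
      (volume (Metric.ball (0 : Rn n) 1)).toReal) (b := 1) hp hN hfm hf hl
    (by positivity) zero_le_one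
    (w := (Metric.ball c r).indicator 1) (measurable_one.indicator measurableSet_ball)
    (by rw [lintegral_indicator_one measurableSet_ball, hv])
    (by
      intro y
      rw [ENNReal.ofReal_one]
      exact indicator_le_self' (fun _ _ => zero_le) y)
  have e : ∫⁻ y in Metric.ball c r, ‖f y‖ₑ =
      ∫⁻ y, (Metric.ball c r).indicator 1 y * ‖f y‖ₑ := by
    rw [← lintegral_indicator measurableSet_ball]
    refine lintegral_congr fun y => ?_
    by_cases h : y ∈ Metric.ball c r <;> simp [h]
  rw [e]
  refine key.trans (le_of_eq ?_)
  congr 1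
  have h1 : N / (r ^ (-α) * N) = r ^ α := by
    rw [Real.rpow_neg hr.le]; field_simp
  have h2 : (r ^ α) ^ (n / α : ℝ) = r ^ (n : ℝ) := by
    rw [← Real.rpow_mul hr.le]; congr 1; field_simp
  rw [h1, h2, Real.rpow_sub hr, Real.rpow_neg hr.le]
  field_simp

/-! ### Gaussian majorant and the heat operator on weak `L^{n/α}` -/

/-- A jointly measurable kernel with a Gaussian upper bound. -/
structure GaussianBound (P : ℝ → Rn n → Rn n → ℂ) (C A : ℝ) : Prop where
  measurable : Measurable fun q : ℝ × Rn n × Rn n => P q.1 q.2.1 q.2.2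
  const_pos : 0 < C
  rate_pos : 0 < A
  bound : ∀ t : ℝ, 0 < t → ∀ x y : Rn n,
    ‖P t x y‖ ≤ C / t ^ ((n : ℝ) / 2) * Real.exp (-(A * ‖x - y‖ ^ 2 / t))

/-- The Gaussian majorant of the kernel, as a function of `x - y`. -/
noncomputable def gaussianMajorant (C A t : ℝ) (z : Rn n) : ℝ≥0∞ :=
  ENNReal.ofReal (C / t ^ ((n : ℝ) / 2) * Real.exp (-(A * ‖z‖ ^ 2 / t)))

/-- The absolute heat operator `∫ |P_t(x,y)| |f(y)| dy`. -/
noncomputable def heatAbs (P : ℝ → Rn n → Rn n → ℂ) (t : ℝ) (f : Rn n → ℂ) (x : Rn n) : ℝ≥0∞ :=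
  ∫⁻ y, ‖P t x y‖ₑ * ‖f y‖ₑ

theorem measurable_gaussianMajorant (C A t : ℝ) :
    Measurable (gaussianMajorant C A t : Rn n → ℝ≥0∞) := by
  unfold gaussianMajorant
  fun_prop

theorem gaussianMajorant_le {C A t : ℝ} (hC : 0 < C) (hA : 0 < A) (ht : 0 < t) (z : Rn n) :
    gaussianMajorant C A t z ≤ ENNReal.ofReal (C * t ^ (-((n : ℝ) / 2))) := by
  refine ENNReal.ofReal_le_ofReal ?_
  rw [Real.rpow_neg ht.le, ← div_eq_mul_inv]
  refine mul_le_of_le_one_right (by positivity) (Real.exp_le_one_iff.2 ?_)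
  have : 0 ≤ A * ‖z‖ ^ 2 / t := by positivity
  linarith

theorem lintegral_gaussianMajorant {C A t : ℝ} (hC : 0 < C) (hA : 0 < A) (ht : 0 < t) :
    ∫⁻ z : Rn n, gaussianMajorant C A t z = ENNReal.ofReal (C * (Real.pi / A) ^ ((n : ℝ) / 2)) := by
  have hb : 0 < A / t := by positivity
  have hI := GaussianFourier.integral_rexp_neg_mul_sq_norm (V := Rn n) hb
  have hpos : 0 < (Real.pi / (A / t)) ^ ((n : ℝ) / 2) := by positivity
  rw [finrank_euclideanSpace_fin] at hI
  -- A non-integrable function has integral `0` by convention, so the positive value in `hI` forces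
  -- integrability.
  have hint : Integrable fun v : Rn n => Real.exp (-(A / t) * ‖v‖ ^ 2) := by
    by_contra h
    rw [integral_undef h] at hI
    exact hpos.ne hI
  have e : ∀ z : Rn n, gaussianMajorant C A t z =
      ENNReal.ofReal (C / t ^ ((n : ℝ) / 2) * Real.exp (-(A / t) * ‖z‖ ^ 2)) := by
    intro z
    unfold gaussianMajorant
    congr 3
    ring
  simp_rw [e]
  rw [← ofReal_integral_eq_lintegral_ofReal (hint.const_mul _)
    (Eventually.of_forall fun _ => by positivity), integral_const_mul, hI]
  congr 1
  rw [show Real.pi / (A / t) = Real.pi / A * t by field_simp,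
    Real.mul_rpow (by positivity) ht.le]
  have := (Real.rpow_pos_of_pos ht ((n : ℝ) / 2)).ne'
  field_simp

theorem lintegral_gaussianMajorant_sub {C A t : ℝ} (hC : 0 < C) (hA : 0 < A) (ht : 0 < t)
    (x : Rn n) : ∫⁻ y : Rn n, gaussianMajorant C A t (x - y) =
      ENNReal.ofReal (C * (Real.pi / A) ^ ((n : ℝ) / 2)) := by
  rw [lintegral_sub_left_eq_self (fun y => gaussianMajorant C A t y) x]
  exact lintegral_gaussianMajorant hC hA ht

theorem lintegral_gaussianMajorant_sub_right {C A t : ℝ} (hC : 0 < C) (hA : 0 < A) (ht : 0 < t)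
    (y : Rn n) : ∫⁻ x : Rn n, gaussianMajorant C A t (x - y) =
      ENNReal.ofReal (C * (Real.pi / A) ^ ((n : ℝ) / 2)) := by
  rw [lintegral_sub_right_eq_self (fun y => gaussianMajorant C A t y) y]
  exact lintegral_gaussianMajorant hC hA ht

namespace GaussianBound

variable {P : ℝ → Rn n → Rn n → ℂ} {C A : ℝ} (hP : GaussianBound P C A)
include hP

theorem enorm_le {t : ℝ} (ht : 0 < t) (x y : Rn n) :
    ‖P t x y‖ₑ ≤ gaussianMajorant C A t (x - y) := by
  rw [← ofReal_norm]
  exact ENNReal.ofReal_le_ofReal (hP.bound t ht x y)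

theorem heatAbs_le_majorant {t : ℝ} (ht : 0 < t) (f : Rn n → ℂ) (x : Rn n) :
    heatAbs P t f x ≤ ∫⁻ y, gaussianMajorant C A t (x - y) * ‖f y‖ₑ :=
  lintegral_mono fun y => mul_le_mul_left (hP.enorm_le ht x y) _

theorem measurable_right (t : ℝ) (x : Rn n) : Measurable (P t x) :=
  hP.measurable.comp (by fun_prop : Measurable fun y : Rn n => (t, x, y))

theorem measurable_heatAbs {f : Rn n → ℂ} (hf : Measurable f) :
    Measurable fun q : ℝ × Rn n => heatAbs P q.1 f q.2 := by
  refine Measurable.lintegral_prod_right' (f := fun q : (ℝ × Rn n) × Rn n =>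
    ‖P q.1.1 q.1.2 q.2‖ₑ * ‖f q.2‖ₑ) ?_
  have h : Measurable fun q : (ℝ × Rn n) × Rn n => P q.1.1 q.1.2 q.2 :=
    hP.measurable.comp (by fun_prop : Measurable fun q : (ℝ × Rn n) × Rn n => (q.1.1, q.1.2, q.2))
  exact h.enorm.mul (hf.comp measurable_snd).enorm

theorem stronglyMeasurable_heat {f : Rn n → ℂ} (hf : Measurable f) :
    StronglyMeasurable fun q : ℝ × Rn n => heat P q.1 f q.2 := by
  refine StronglyMeasurable.integral_prod_right (f := fun (q : ℝ × Rn n) (y : Rn n) =>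
    P q.1 q.2 y * f y) ?_
  have h : Measurable fun q : (ℝ × Rn n) × Rn n => P q.1.1 q.1.2 q.2 :=
    hP.measurable.comp (by fun_prop : Measurable fun q : (ℝ × Rn n) × Rn n => (q.1.1, q.1.2, q.2))
  exact (h.mul (hf.comp measurable_snd)).stronglyMeasurable

theorem measurable_heatAbs_space {f : Rn n → ℂ} (hf : Measurable f) (t : ℝ) :
    Measurable (heatAbs P t f) :=
  (hP.measurable_heatAbs hf).comp (by fun_prop : Measurable fun x : Rn n => (t, x))

theorem measurable_heat_space {f : Rn n → ℂ} (hf : Measurable f) (t : ℝ) :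
    Measurable (heat P t f) :=
  (hP.stronglyMeasurable_heat hf).measurable.comp
    (by fun_prop : Measurable fun x : Rn n => (t, x))

theorem integrable_mul {f : Rn n → ℂ} (hf : Measurable f) {t : ℝ} {x : Rn n}
    (h : heatAbs P t f x < ∞) : Integrable fun y => P t x y * f y := by
  refine ⟨((hP.measurable_right t x).mul hf).aestronglyMeasurable, ?_⟩
  simp only [HasFiniteIntegral, enorm_mul]
  exact h

/-- The uniform bound of the heat operator on weak `L^{n/α}`. -/
theorem exists_heatAbs_le {α : ℝ} (hα : 0 < α) (hαn : α < n) :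
    ∃ K : ℝ, 0 < K ∧ ∀ (f : Rn n → ℂ) (N : ℝ), Measurable f → 0 < N →
      weakNorm (n / α) f ≤ ENNReal.ofReal N → ∀ (t : ℝ) (x : Rn n), 0 < t →
        heatAbs P t f x ≤ ENNReal.ofReal (K * t ^ (-(α / 2)) * N) := by
  have hC := hP.const_pos
  have hA := hP.rate_pos
  have hn : 0 < (n : ℝ) := hα.trans hαn
  have hp : 1 < n / α := by rwa [one_lt_div hα]
  have hp1 : 0 < n / α - 1 := by linarith
  refine ⟨C * (Real.pi / A) ^ ((n : ℝ) / 2) + C * ((n / α) / (n / α - 1)),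
    by positivity, fun f N hfm hN hf t x ht => ?_⟩
  refine (hP.heatAbs_le_majorant ht f x).trans ?_
  -- At this height `(N/l)^(n/α) = t^(n/2)`, which cancels the supremum `C t^(-n/2)` of the
  -- Gaussian.
  have hl : 0 < t ^ (-(α / 2)) * N := by positivity
  refine (lintegral_mul_le_of_weakNorm_le hp hN hfm hf hl
    (a := C * (Real.pi / A) ^ ((n : ℝ) / 2)) (b := C * t ^ (-((n : ℝ) / 2)))
    (by positivity) (by positivity)
    ((measurable_gaussianMajorant C A t).comp (measurable_const.sub measurable_id))
    (lintegral_gaussianMajorant_sub hC hA ht x).le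
    (fun y => gaussianMajorant_le hC hA ht (x - y))).trans (le_of_eq ?_)
  congr 1
  have h1 : N / (t ^ (-(α / 2)) * N) = t ^ (α / 2) := by
    rw [Real.rpow_neg ht.le]; field_simp
  have h2 : (t ^ (α / 2)) ^ (n / α : ℝ) = t ^ ((n : ℝ) / 2) := by
    rw [← Real.rpow_mul ht.le]; congr 1; field_simp
  rw [h1, h2, Real.rpow_neg ht.le ((n : ℝ) / 2)]
  field_simp

/-- The averages of the heat operator over balls, uniformly in time. -/
theorem exists_lintegral_ball_heatAbs_le {α : ℝ} (hα : 0 < α) (hαn : α < n) :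
    ∃ K : ℝ, 0 < K ∧ ∀ (f : Rn n → ℂ) (N : ℝ), Measurable f → 0 < N →
      weakNorm (n / α) f ≤ ENNReal.ofReal N → ∀ (t : ℝ) (c : Rn n) (r : ℝ), 0 < t → 0 < r →
        ∫⁻ x in Metric.ball c r, heatAbs P t f x ≤
          ENNReal.ofReal (K * r ^ ((n : ℝ) - α) * N) := by
  have hC := hP.const_pos
  have hA := hP.rate_pos
  have hn : 0 < (n : ℝ) := hα.trans hαn
  have hp : 1 < n / α := by rwa [one_lt_div hα]
  have hp1 : 0 < n / α - 1 := by linarith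
  refine ⟨C * (Real.pi / A) ^ ((n : ℝ) / 2) *
    ((volume (Metric.ball (0 : Rn n) 1)).toReal + (n / α) / (n / α - 1)),
    by positivity, fun f N hfm hN hf t c r ht hr => ?_⟩
  have hg := measurable_gaussianMajorant (n := n) C A t
  calc ∫⁻ x in Metric.ball c r, heatAbs P t f x
      ≤ ∫⁻ x in Metric.ball c r, ∫⁻ z, gaussianMajorant C A t z * ‖f (x - z)‖ₑ := by
        refine lintegral_mono fun x => (hP.heatAbs_le_majorant ht f x).trans (le_of_eq ?_)
        rw [← lintegral_sub_left_eq_self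
          (fun z => gaussianMajorant C A t z * ‖f (x - z)‖ₑ) x]
        simp only [sub_sub_cancel]
    _ = ∫⁻ z, ∫⁻ x in Metric.ball c r, gaussianMajorant C A t z * ‖f (x - z)‖ₑ := by
        refine lintegral_lintegral_swap ?_
        refine Measurable.aemeasurable ?_
        exact (hg.comp measurable_snd).mul (hfm.comp (measurable_fst.sub measurable_snd)).enorm
    _ = ∫⁻ z, gaussianMajorant C A t z * ∫⁻ x in Metric.ball c r, ‖f (x - z)‖ₑ := by
        refine lintegral_congr fun z => lintegral_const_mul _ ?_
        exact (hfm.comp (measurable_id.sub measurable_const)).enorm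
    -- The ball bound does not depend on the centre, so the shifted balls `B(c - z, r)` share it and
    -- only the mass of the Gaussian remains, which is free of `t`.
    _ ≤ ∫⁻ z : Rn n, gaussianMajorant C A t z * ENNReal.ofReal
          (((volume (Metric.ball (0 : Rn n) 1)).toReal + (n / α) / (n / α - 1)) *
            r ^ ((n : ℝ) - α) * N) := by
        refine lintegral_mono fun z => mul_le_mul_right ?_ _
        refine le_trans (le_of_eq ?_) (lintegral_ball_le hα hαn hN hfm hf hr (c - z))
        rw [← lintegral_indicator measurableSet_ball, ← lintegral_indicator measurableSet_ball,
          ← lintegral_sub_right_eq_self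
            (fun x => (Metric.ball (c - z) r).indicator (fun y => ‖f y‖ₑ) x) z]
        refine lintegral_congr fun x => ?_
        have : x ∈ Metric.ball c r ↔ x - z ∈ Metric.ball (c - z) r := by
          simp
        by_cases h : x ∈ Metric.ball c r
        · rw [indicator_of_mem h, indicator_of_mem (this.1 h)]
        · rw [indicator_of_notMem h, indicator_of_notMem (fun h' => h (this.2 h'))]
    _ = _ := by
        rw [lintegral_mul_const _ hg, lintegral_gaussianMajorant hC hA ht,
          ← ENNReal.ofReal_mul (by positivity)]
        congr 1
        ring

end GaussianBound

theorem enorm_heat_le {P : ℝ → Rn n → Rn n → ℂ} (t : ℝ) (f : Rn n → ℂ) (x : Rn n) :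
    ‖heat P t f x‖ₑ ≤ heatAbs P t f x := by
  refine (enorm_integral_le_lintegral_enorm _).trans (le_of_eq ?_)
  simp only [enorm_mul, heatAbs]

/-! ### Sectors and the Cauchy estimate -/

theorem ofReal_mul_mem_sector {θ : ℝ} {z : ℂ} (hz : z ∈ sector θ) {t : ℝ} (ht : 0 < t) :
    (t : ℂ) * z ∈ sector θ := by
  refine ⟨mul_ne_zero (by exact_mod_cast ht.ne') hz.1, ?_⟩
  rw [Complex.arg_real_mul _ ht]
  exact hz.2

theorem ofReal_mem_sector {θ : ℝ} (hθ : 0 < θ) {t : ℝ} (ht : 0 < t) : (t : ℂ) ∈ sector θ := by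
  refine ⟨by exact_mod_cast ht.ne', ?_⟩
  rwa [Complex.arg_ofReal_of_nonneg ht.le, abs_zero]

theorem sector_mono {θ θ' : ℝ} (h : θ ≤ θ') : sector θ ⊆ sector θ' :=
  fun _ hz => ⟨hz.1, hz.2.trans_le h⟩

/-- The sector is a neighbourhood of `1` and a cone: a small ball about `1` scaled by `t` stays
inside. The linear radius is what makes the Cauchy estimate scale like `1/t`. -/
theorem exists_closedBall_subset_sector {θ : ℝ} (hθ : 0 < θ) :
    ∃ k : ℝ, 0 < k ∧ ∀ t : ℝ, 0 < t → Metric.closedBall (t : ℂ) (k * t) ⊆ sector θ := by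
  have h1 : sector θ ∈ 𝓝 (1 : ℂ) := by
    have hc : ContinuousAt (fun z : ℂ => |z.arg|) 1 :=
      (Complex.continuousAt_arg (by simp)).abs
    have h2 : ∀ᶠ z : ℂ in 𝓝 1, |z.arg| < θ :=
      hc.eventually_lt continuousAt_const (by simpa using hθ)
    filter_upwards [h2, eventually_ne_nhds one_ne_zero] with z h h'
    exact ⟨h', h⟩
  obtain ⟨k, hk, hsub⟩ := Metric.nhds_basis_closedBall.mem_iff.1 h1
  refine ⟨k, hk, fun t ht z hz => ?_⟩
  have ht' : (t : ℂ) ≠ 0 := by exact_mod_cast ht.ne'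
  have h3 : z / t ∈ sector θ := by
    refine hsub ?_
    rw [Metric.mem_closedBall, dist_eq_norm] at hz ⊢
    rw [show z / t - 1 = (z - t) / t by field_simp, norm_div, Complex.norm_real,
      Real.norm_of_nonneg ht.le, div_le_iff₀ ht]
    exact hz
  have h4 := ofReal_mul_mem_sector h3 ht
  rwa [mul_div_cancel₀ _ ht'] at h4

/-- The Cauchy estimate for a bounded analytic semigroup. -/
theorem IsBoundedAnalyticSemigroup.exists_norm_sub_le {H : Type*} [NormedAddCommGroup H]
    [NormedSpace ℂ H] [CompleteSpace H] {θ : ℝ} {S : ℂ → H →L[ℂ] H}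
    (hS : IsBoundedAnalyticSemigroup θ S) :
    ∃ M : ℝ, 0 < M ∧ ∀ t s : ℝ, 0 < t → 0 < s →
      ‖S (t : ℂ) - S ((t + s : ℝ) : ℂ)‖ ≤ M * (s / t) := by
  have hθ := hS.angle_pos
  -- Uniform bounds hold only on strictly smaller sectors; half the angle is enough.
  obtain ⟨M, hM⟩ := hS.bounded (θ / 2) (by linarith) (by linarith)
  obtain ⟨k, hk, hsub⟩ := exists_closedBall_subset_sector (θ := θ / 2) (by linarith)
  have hsub' : ∀ t : ℝ, 0 < t → Metric.closedBall (t : ℂ) (k * t) ⊆ sector θ :=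
    fun t ht => (hsub t ht).trans (sector_mono (by linarith))
  have hM0 : 0 ≤ M := (norm_nonneg _).trans
    (hM _ (ofReal_mem_sector (θ := θ / 2) (by linarith) one_pos))
  -- `M` may be `0`; the `+ 1` only keeps the constant positive.
  refine ⟨(M + 1) / k, by positivity, fun t s ht hs => ?_⟩
  have hder : ∀ τ ∈ Icc t (t + s), HasDerivWithinAt (fun τ : ℝ => S (τ : ℂ))
      (deriv S (τ : ℂ)) (Icc t (t + s)) τ := by
    intro τ hτ
    have hτ0 : 0 < τ := ht.trans_le hτ.1
    have hd : DifferentiableAt ℂ S (τ : ℂ) := by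
      refine hS.holomorphic.differentiableAt ?_
      exact mem_of_superset (Metric.closedBall_mem_nhds _ (by positivity)) (hsub' τ hτ0)
    have hof : HasDerivAt (fun τ : ℝ => (τ : ℂ)) 1 τ := Complex.ofRealCLM.hasDerivAt
    have hcomp := HasDerivAt.scomp τ hd.hasDerivAt hof
    rw [one_smul] at hcomp
    exact hcomp.hasDerivWithinAt
  have hbd : ∀ τ ∈ Icc t (t + s), ‖deriv S (τ : ℂ)‖ ≤ (M + 1) / (k * t) := by
    intro τ hτ
    have hτ0 : 0 < τ := ht.trans_le hτ.1
    have hR : 0 < k * τ := by positivity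
    have h := Complex.norm_deriv_le_of_forall_mem_sphere_norm_le (f := S) (c := (τ : ℂ))
      (C := M) hR
      (DifferentiableOn.diffContOnCl (hS.holomorphic.mono
        (by rw [closure_ball _ hR.ne']; exact hsub' τ hτ0)))
      (fun z hz => hM z (hsub τ hτ0 (Metric.sphere_subset_closedBall hz)))
    refine h.trans ?_
    gcongr
    · linarith
    · exact hτ.1
  have h := (convex_Icc t (t + s)).norm_image_sub_le_of_norm_hasDerivWithin_le hder hbd
    (x := t + s) (y := t) ⟨by linarith, le_rfl⟩ ⟨le_rfl, by linarith⟩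
  refine h.trans (le_of_eq ?_)
  rw [Real.norm_eq_abs, show t - (t + s) = -s by ring, abs_neg, abs_of_pos hs]
  field_simp


/-! ### Truncation, and the heat operator between `L¹`, `L²` and `L^∞` -/

theorem lintegral_mul_le_sqrt_mul_sqrt {X : Type*} [MeasurableSpace X] {μ : Measure X}
    {f g : X → ℝ≥0∞} (hf : AEMeasurable f μ) (hg : AEMeasurable g μ) :
    ∫⁻ x, f x * g x ∂μ ≤
      (∫⁻ x, f x ^ 2 ∂μ) ^ (1 / 2 : ℝ) * (∫⁻ x, g x ^ 2 ∂μ) ^ (1 / 2 : ℝ) := by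
  have h := ENNReal.lintegral_mul_le_Lp_mul_Lq μ Real.HolderConjugate.two_two hf hg
  simpa only [ENNReal.rpow_two, Pi.mul_apply] using h

theorem eLpNorm_two_eq {X E : Type*} [MeasurableSpace X] [NormedAddCommGroup E] {μ : Measure X}
    (f : X → E) : eLpNorm f 2 μ = (∫⁻ x, ‖f x‖ₑ ^ 2 ∂μ) ^ (1 / 2 : ℝ) := by
  rw [eLpNorm_eq_lintegral_rpow_enorm_toReal two_ne_zero ENNReal.ofNat_ne_top]
  simp only [ENNReal.toReal_ofNat, ENNReal.rpow_two]

/-- Truncation of a function in height and in space. -/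
noncomputable def truncation (k : ℕ) (f : Rn n → ℂ) : Rn n → ℂ :=
  ({x | ‖f x‖ ≤ k} ∩ Metric.closedBall 0 k).indicator f

theorem measurable_truncation {f : Rn n → ℂ} (hf : Measurable f) (k : ℕ) :
    Measurable (truncation k f) :=
  hf.indicator ((measurableSet_le hf.norm measurable_const).inter measurableSet_closedBall)

theorem enorm_truncation_le (k : ℕ) (f : Rn n → ℂ) (x : Rn n) : ‖truncation k f x‖ₑ ≤ ‖f x‖ₑ :=
  enorm_indicator_le_enorm_self _ _

theorem memLp_truncation {f : Rn n → ℂ} (hf : Measurable f) (k : ℕ) (p : ℝ≥0∞) :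
    MemLp (truncation k f) p volume := by
  have hE : MeasurableSet ({x | ‖f x‖ ≤ k} ∩ Metric.closedBall (0 : Rn n) k) :=
    (measurableSet_le hf.norm measurable_const).inter measurableSet_closedBall
  unfold truncation
  rw [memLp_indicator_iff_restrict hE]
  have hfin : volume ({x | ‖f x‖ ≤ k} ∩ Metric.closedBall (0 : Rn n) k) < ∞ :=
    (measure_mono inter_subset_right).trans_lt measure_closedBall_lt_top
  have : IsFiniteMeasure (volume.restrict ({x | ‖f x‖ ≤ k} ∩ Metric.closedBall (0 : Rn n) k)) :=
    ⟨by rwa [Measure.restrict_apply_univ]⟩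
  refine MemLp.of_bound hf.aestronglyMeasurable k ?_
  filter_upwards [ae_restrict_mem hE] with x hx using hx.1

theorem tendsto_truncation (f : Rn n → ℂ) (x : Rn n) :
    Tendsto (fun k => truncation k f x) atTop (𝓝 (f x)) := by
  refine tendsto_const_nhds.congr' ?_
  obtain ⟨m, hm⟩ := exists_nat_ge (max ‖f x‖ ‖x‖)
  filter_upwards [eventually_ge_atTop m] with k hk
  have hk' : (m : ℝ) ≤ k := by exact_mod_cast hk
  have hmem : x ∈ {x | ‖f x‖ ≤ k} ∩ Metric.closedBall 0 (k : ℝ) := by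
    refine ⟨((le_max_left _ _).trans hm).trans hk', ?_⟩
    rw [mem_closedBall_zero_iff]
    exact ((le_max_right _ _).trans hm).trans hk'
  exact (indicator_of_mem hmem f).symm

theorem heatAbs_mono {P : ℝ → Rn n → Rn n → ℂ} {f g : Rn n → ℂ} (h : ∀ y, ‖f y‖ₑ ≤ ‖g y‖ₑ)
    (t : ℝ) (x : Rn n) : heatAbs P t f x ≤ heatAbs P t g x :=
  lintegral_mono fun y => mul_le_mul_right (h y) _

theorem heat_congr_ae (P : ℝ → Rn n → Rn n → ℂ) {f g : Rn n → ℂ} (h : f =ᵐ[volume] g) (t : ℝ)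
    (x : Rn n) : heat P t f x = heat P t g x := by
  refine integral_congr_ae ?_
  filter_upwards [h] with y hy
  rw [hy]

namespace GaussianBound

variable {P : ℝ → Rn n → Rn n → ℂ} {C A : ℝ}

/-- Dominated convergence for the heat operator. -/
theorem tendsto_heat (hP : GaussianBound P C A) {t : ℝ} {x : Rn n} {g : ℕ → Rn n → ℂ}
    {h : Rn n → ℂ} {F : Rn n → ℝ≥0∞} (hg : ∀ k, Measurable (g k)) (hF : Measurable F)
    (hle : ∀ k y, ‖g k y‖ₑ ≤ F y) (hfin : ∫⁻ y, ‖P t x y‖ₑ * F y < ∞)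
    (hlim : ∀ y, Tendsto (fun k => g k y) atTop (𝓝 (h y))) :
    Tendsto (fun k => heat P t (g k) x) atTop (𝓝 (heat P t h x)) := by
  have hm := hP.measurable_right t x
  have hae : ∀ᵐ y, ‖P t x y‖ₑ * F y < ∞ := ae_lt_top (hm.enorm.mul hF) hfin.ne
  refine tendsto_integral_of_dominated_convergence (fun y => (‖P t x y‖ₑ * F y).toReal)
    (fun k => (hm.mul (hg k)).aestronglyMeasurable)
    (integrable_toReal_of_lintegral_ne_top (hm.enorm.mul hF).aemeasurable hfin.ne)
    (fun k => ?_) (Eventually.of_forall fun y => (hlim y).const_mul _)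
  filter_upwards [hae] with y hy
  rw [← toReal_enorm, enorm_mul]
  exact ENNReal.toReal_mono hy.ne (mul_le_mul_right (hle k y) _)

theorem tendsto_heat_truncation (hP : GaussianBound P C A) {t : ℝ} {x : Rn n} {f : Rn n → ℂ}
    (hf : Measurable f) (hfin : heatAbs P t f x < ∞) :
    Tendsto (fun k => heat P t (truncation k f) x) atTop (𝓝 (heat P t f x)) :=
  hP.tendsto_heat (measurable_truncation hf) hf.enorm (fun k y => enorm_truncation_le k f y) hfin
    (tendsto_truncation f)

/-- The squared `L²` bound of the kernel in the second variable. -/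
theorem lintegral_sq_le (hP : GaussianBound P C A) {t : ℝ} (ht : 0 < t) (x : Rn n) :
    ∫⁻ y, ‖P t x y‖ₑ ^ 2 ≤ ENNReal.ofReal (C * t ^ (-((n : ℝ) / 2))) *
      ENNReal.ofReal (C * (Real.pi / A) ^ ((n : ℝ) / 2)) := by
  have hC := hP.const_pos
  have hA := hP.rate_pos
  rw [← lintegral_gaussianMajorant_sub hC hA ht x, ← lintegral_const_mul]
  · refine lintegral_mono fun y => ?_
    rw [sq]
    exact mul_le_mul' ((hP.enorm_le ht x y).trans (gaussianMajorant_le hC hA ht _))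
      (hP.enorm_le ht x y)
  · exact (measurable_gaussianMajorant C A t).comp (measurable_const.sub measurable_id)

/-- The heat operator from `L²` to `L^∞`. -/
theorem heatAbs_le_eLpNorm_two (hP : GaussianBound P C A) {t : ℝ} (ht : 0 < t) {w : Rn n → ℂ}
    (hw : AEStronglyMeasurable w volume) (x : Rn n) :
    heatAbs P t w x ≤ (ENNReal.ofReal (C * t ^ (-((n : ℝ) / 2))) *
      ENNReal.ofReal (C * (Real.pi / A) ^ ((n : ℝ) / 2))) ^ (1 / 2 : ℝ) * eLpNorm w 2 volume := by
  rw [eLpNorm_two_eq]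
  refine (lintegral_mul_le_sqrt_mul_sqrt (hP.measurable_right t x).enorm.aemeasurable
    hw.enorm).trans ?_
  gcongr
  exact hP.lintegral_sq_le ht x

/-- The heat operator from `L¹` to `L^∞`. -/
theorem heatAbs_le_lintegral (hP : GaussianBound P C A) {t : ℝ} (ht : 0 < t) {u : Rn n → ℂ}
    (hu : Measurable u) (x : Rn n) :
    heatAbs P t u x ≤ ENNReal.ofReal (C * t ^ (-((n : ℝ) / 2))) * ∫⁻ y, ‖u y‖ₑ := by
  rw [← lintegral_const_mul _ hu.enorm]
  exact lintegral_mono fun y => mul_le_mul_left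
    ((hP.enorm_le ht x y).trans (gaussianMajorant_le hP.const_pos hP.rate_pos ht _)) _

/-- The heat operator on bounded functions. -/
theorem lintegral_mul_const_le (hP : GaussianBound P C A) {t : ℝ} (ht : 0 < t)
    {F : Rn n → ℝ≥0∞} {b : ℝ≥0∞} (hF : ∀ y, F y ≤ b) (x : Rn n) :
    ∫⁻ y, ‖P t x y‖ₑ * F y ≤ ENNReal.ofReal (C * (Real.pi / A) ^ ((n : ℝ) / 2)) * b := by
  have hg : Measurable fun y : Rn n => gaussianMajorant C A t (x - y) :=
    (measurable_gaussianMajorant C A t).comp (measurable_const.sub measurable_id)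
  rw [← lintegral_gaussianMajorant_sub hP.const_pos hP.rate_pos ht x,
    ← lintegral_mul_const _ hg]
  exact lintegral_mono fun y => mul_le_mul' (hP.enorm_le ht x y) (hF y)

/-- The heat operator on `L¹`. -/
theorem lintegral_heatAbs_le (hP : GaussianBound P C A) {t : ℝ} (ht : 0 < t) {u : Rn n → ℂ}
    (hu : Measurable u) : ∫⁻ x, heatAbs P t u x ≤
      ENNReal.ofReal (C * (Real.pi / A) ^ ((n : ℝ) / 2)) * ∫⁻ y, ‖u y‖ₑ := by
  have hg := measurable_gaussianMajorant (n := n) C A t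
  calc ∫⁻ x, heatAbs P t u x
      ≤ ∫⁻ x, ∫⁻ y, gaussianMajorant C A t (x - y) * ‖u y‖ₑ :=
        lintegral_mono fun x => hP.heatAbs_le_majorant ht u x
    _ = ∫⁻ y, ∫⁻ x, gaussianMajorant C A t (x - y) * ‖u y‖ₑ := by
        refine lintegral_lintegral_swap (Measurable.aemeasurable ?_)
        exact (hg.comp (measurable_fst.sub measurable_snd)).mul (hu.comp measurable_snd).enorm
    _ = _ := by
        rw [← lintegral_const_mul _ hu.enorm]
        refine lintegral_congr fun y => ?_
        have hg' : Measurable fun x : Rn n => gaussianMajorant C A t (x - y) :=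
          hg.comp (measurable_id.sub measurable_const)
        rw [lintegral_mul_const _ hg',
          lintegral_gaussianMajorant_sub_right hP.const_pos hP.rate_pos ht]

/-- The heat operator from `L¹` to `L²`. -/
theorem eLpNorm_two_heat_le (hP : GaussianBound P C A) {t : ℝ} (ht : 0 < t) {u : Rn n → ℂ}
    (hu : Measurable u) : eLpNorm (heat P t u) 2 volume ≤
      (ENNReal.ofReal (C * t ^ (-((n : ℝ) / 2))) *
        ENNReal.ofReal (C * (Real.pi / A) ^ ((n : ℝ) / 2))) ^ (1 / 2 : ℝ) * ∫⁻ y, ‖u y‖ₑ := by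
  rw [eLpNorm_two_eq]
  have key : ∫⁻ x, ‖heat P t u x‖ₑ ^ 2 ≤ (ENNReal.ofReal (C * t ^ (-((n : ℝ) / 2))) *
      ENNReal.ofReal (C * (Real.pi / A) ^ ((n : ℝ) / 2))) * (∫⁻ y, ‖u y‖ₑ) ^ 2 := by
    calc ∫⁻ x, ‖heat P t u x‖ₑ ^ 2
        ≤ ∫⁻ x, (ENNReal.ofReal (C * t ^ (-((n : ℝ) / 2))) * ∫⁻ y, ‖u y‖ₑ) *
            heatAbs P t u x := by
          refine lintegral_mono fun x => ?_
          rw [sq]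
          exact mul_le_mul' ((enorm_heat_le t u x).trans (hP.heatAbs_le_lintegral ht hu x))
            (enorm_heat_le t u x)
      _ ≤ (ENNReal.ofReal (C * t ^ (-((n : ℝ) / 2))) * ∫⁻ y, ‖u y‖ₑ) *
            (ENNReal.ofReal (C * (Real.pi / A) ^ ((n : ℝ) / 2)) * ∫⁻ y, ‖u y‖ₑ) := by
          rw [lintegral_const_mul _ (hP.measurable_heatAbs_space hu t)]
          exact mul_le_mul_right (hP.lintegral_heatAbs_le ht hu) _
      _ = _ := by ring
  refine (ENNReal.rpow_le_rpow key (by norm_num)).trans (le_of_eq ?_)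
  rw [ENNReal.mul_rpow_of_nonneg _ _ (by norm_num), ← ENNReal.rpow_two, ← ENNReal.rpow_mul]
  norm_num

end GaussianBound

/-! ### Semigroup law and time regularity beyond `L²` -/

theorem HasGaussianKernel.exists_gaussianBound {S : ℂ → L2 n →L[ℂ] L2 n}
    {P : ℝ → Rn n → Rn n → ℂ} (hK : HasGaussianKernel S P) : ∃ C A : ℝ, GaussianBound P C A := by
  obtain ⟨C, A, hC, hA, h⟩ := hK.gaussian_bound
  exact ⟨C, A, hK.measurable, hC, hA, h⟩

theorem HasGaussianKernel.coe_apply_ae {S : ℂ → L2 n →L[ℂ] L2 n} {P : ℝ → Rn n → Rn n → ℂ}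
    (hK : HasGaussianKernel S P) {t : ℝ} (ht : 0 < t) {u : Rn n → ℂ} {U : L2 n}
    (hu : (U : Rn n → ℂ) =ᵐ[volume] u) : (S (t : ℂ) U : Rn n → ℂ) =ᵐ[volume] heat P t u := by
  filter_upwards [hK.represents t ht U] with x hx
  rw [hx, ← heat_congr_ae P hu t x]
  rfl

theorem IsBoundedAnalyticSemigroup.apply_add {H : Type*} [NormedAddCommGroup H]
    [NormedSpace ℂ H] {θ : ℝ} {S : ℂ → H →L[ℂ] H} (hS : IsBoundedAnalyticSemigroup θ S)
    {s t : ℝ} (hs : 0 < s) (ht : 0 < t) (u : H) :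
    S ((s + t : ℝ) : ℂ) u = S (s : ℂ) (S (t : ℂ) u) := by
  rw [Complex.ofReal_add, hS.map_add _ (ofReal_mem_sector hS.angle_pos hs) _
    (ofReal_mem_sector hS.angle_pos ht)]
  rfl

section Semigroup

variable {θ : ℝ} {S : ℂ → L2 n →L[ℂ] L2 n} {P : ℝ → Rn n → Rn n → ℂ} {C A : ℝ}

theorem heat_heat_ae_of_memLp (hS : IsBoundedAnalyticSemigroup θ S) (hK : HasGaussianKernel S P)
    {s t : ℝ} (hs : 0 < s) (ht : 0 < t) {u : Rn n → ℂ} (hu : MemLp u 2 volume) :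
    heat P s (heat P t u) =ᵐ[volume] heat P (s + t) u := by
  have h1 := hK.coe_apply_ae hs (hK.coe_apply_ae ht hu.coeFn_toLp)
  have h2 := hK.coe_apply_ae (add_pos hs ht) hu.coeFn_toLp
  rw [hS.apply_add hs ht] at h2
  exact h1.symm.trans h2

/-- The semigroup property for functions on which the absolute heat operators are bounded. -/
theorem heat_heat_ae (hS : IsBoundedAnalyticSemigroup θ S) (hK : HasGaussianKernel S P)
    (hP : GaussianBound P C A) {s t : ℝ} (hs : 0 < s) (ht : 0 < t) {f : Rn n → ℂ}
    (hf : Measurable f)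
    (hfin : ∀ t : ℝ, 0 < t → ∃ b : ℝ≥0∞, b < ∞ ∧ ∀ x, heatAbs P t f x ≤ b) :
    heat P s (heat P t f) =ᵐ[volume] heat P (s + t) f := by
  have h : ∀ᵐ x, ∀ k : ℕ, heat P s (heat P t (truncation k f)) x =
      heat P (s + t) (truncation k f) x :=
    ae_all_iff.2 fun k => heat_heat_ae_of_memLp hS hK hs ht (memLp_truncation hf k 2)
  obtain ⟨b, hb, hbf⟩ := hfin t ht
  have hlt : ∀ x, heatAbs P t f x < ∞ := fun x => (hbf x).trans_lt hb
  obtain ⟨b', hb', hbf'⟩ := hfin (s + t) (add_pos hs ht)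
  filter_upwards [h] with x hx
  have h1 := hP.tendsto_heat_truncation hf ((hbf' x).trans_lt hb')
  have h2 : Tendsto (fun k => heat P s (heat P t (truncation k f)) x) atTop
      (𝓝 (heat P s (heat P t f) x)) := by
    -- The inner heat operators of the truncations are dominated by `heatAbs P t f`, which is
    -- bounded and hence integrable against the kernel at time `s`.
    refine hP.tendsto_heat (F := heatAbs P t f)
      (fun k => hP.measurable_heat_space (measurable_truncation hf k) t)
      (hP.measurable_heatAbs_space hf t) (fun k y => (enorm_heat_le t _ y).trans
        (heatAbs_mono (enorm_truncation_le k f) t y)) ?_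
      (fun y => hP.tendsto_heat_truncation hf (hlt y))
    exact (hP.lintegral_mul_const_le hs hbf x).trans_lt
      (ENNReal.mul_lt_top ENNReal.ofReal_lt_top hb)
  simp only [hx] at h2
  exact tendsto_nhds_unique h2 h1

/-- The time regularity of the heat operator from `L¹` to `L^∞`. -/
theorem exists_enorm_heat_sub_le_lintegral (hS : IsBoundedAnalyticSemigroup θ S)
    (hK : HasGaussianKernel S P) (hP : GaussianBound P C A) :
    ∃ K : ℝ, 0 < K ∧ ∀ u : Rn n → ℂ, Measurable u → ∫⁻ y, ‖u y‖ₑ < ∞ →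
      ∀ t s : ℝ, 0 < t → 0 < s → ∀ᵐ x, ‖heat P t u x - heat P (t + s) u x‖ₑ ≤
        ENNReal.ofReal (K * (s / t) * t ^ (-((n : ℝ) / 2))) * ∫⁻ y, ‖u y‖ₑ := by
  obtain ⟨M, hM0, hM⟩ := hS.exists_norm_sub_le
  have hC := hP.const_pos
  have hA := hP.rate_pos
  -- Time is shared as `a + a + a`: one factor maps `L¹` to `L²`, the middle one carries the
  -- difference on `L²`, the last maps `L²` to `L^∞`.
  have key : ∀ u : Rn n → ℂ, Measurable u → MemLp u 2 volume →
      ∀ a s : ℝ, 0 < a → 0 < s →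
        ∀ᵐ x, ‖heat P (a + (a + a)) u x - heat P (a + (a + a) + s) u x‖ₑ ≤
        ENNReal.ofReal (C * a ^ (-((n : ℝ) / 2))) *
          ENNReal.ofReal (C * (Real.pi / A) ^ ((n : ℝ) / 2)) *
          ENNReal.ofReal (M * (s / a)) * ∫⁻ y, ‖u y‖ₑ := by
    intro u hu hu2 a s ha hs
    set U : L2 n := hu2.toLp u
    set D := ENNReal.ofReal (C * a ^ (-((n : ℝ) / 2))) *
          ENNReal.ofReal (C * (Real.pi / A) ^ ((n : ℝ) / 2)) with hD
    set V : L2 n := S (a : ℂ) U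
    set W : L2 n := (S (a : ℂ) - S ((a + s : ℝ) : ℂ)) V
    have hW : S (a : ℂ) W =
        S ((a + (a + a) : ℝ) : ℂ) U - S ((a + (a + a) + s : ℝ) : ℂ) U := by
      rw [show a + (a + a) + s = a + ((a + s) + a) by ring, hS.apply_add ha (add_pos ha ha),
        hS.apply_add ha ha, hS.apply_add ha (add_pos (add_pos ha hs) ha),
        hS.apply_add (add_pos ha hs) ha, ← map_sub]
      rfl
    have hV : eLpNorm V 2 volume ≤ D ^ (1 / 2 : ℝ) * ∫⁻ y, ‖u y‖ₑ := by
      rw [eLpNorm_congr_ae (hK.coe_apply_ae ha hu2.coeFn_toLp)]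
      exact hP.eLpNorm_two_heat_le ha hu
    have hWn : eLpNorm W 2 volume ≤ ENNReal.ofReal (M * (s / a)) * eLpNorm V 2 volume := by
      rw [← Lp.enorm_def, ← Lp.enorm_def, ← ofReal_norm, ← ofReal_norm,
        ← ENNReal.ofReal_mul (by positivity)]
      refine ENNReal.ofReal_le_ofReal ?_
      refine (ContinuousLinearMap.le_opNorm _ _).trans ?_
      gcongr
      exact hM a s ha hs
    have e1 := hK.coe_apply_ae (t := a + (a + a)) (by positivity) hu2.coeFn_toLp
    have e2 := hK.coe_apply_ae (t := a + (a + a) + s) (by positivity) hu2.coeFn_toLp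
    have e3 := hK.coe_apply_ae (U := W) ha EventuallyEq.rfl
    rw [hW] at e3
    filter_upwards [e1, e2, e3, Lp.coeFn_sub (S ((a + (a + a) : ℝ) : ℂ) U)
      (S ((a + (a + a) + s : ℝ) : ℂ) U)] with x h1 h2 h3 h4
    rw [← h1, ← h2, ← Pi.sub_apply, ← h4, h3]
    calc ‖heat P a W x‖ₑ ≤ heatAbs P a W x := enorm_heat_le _ _ _
      _ ≤ D ^ (1 / 2 : ℝ) * eLpNorm W 2 volume :=
          hP.heatAbs_le_eLpNorm_two ha (Lp.aestronglyMeasurable W) x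
      _ ≤ D ^ (1 / 2 : ℝ) * (ENNReal.ofReal (M * (s / a)) *
            (D ^ (1 / 2 : ℝ) * ∫⁻ y, ‖u y‖ₑ)) := by
          gcongr
          exact hWn.trans (by gcongr)
      _ = (D ^ (1 / 2 : ℝ) * D ^ (1 / 2 : ℝ)) * ENNReal.ofReal (M * (s / a)) *
            ∫⁻ y, ‖u y‖ₑ := by ring
      _ = _ := by
          rw [← ENNReal.rpow_add_of_nonneg _ _ (by norm_num) (by norm_num)]
          norm_num
  -- With `a = t/3`, the factor `3^(n/2)` comes from `a^(-n/2)` and the factor `3` from `s/a`.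
  refine ⟨C * 3 ^ ((n : ℝ) / 2) * (C * (Real.pi / A) ^ ((n : ℝ) / 2)) * (M * 3), by positivity,
    fun u hu hufin t s ht hs => ?_⟩
  have hall : ∀ᵐ x, ∀ k : ℕ, _ := ae_all_iff.2 fun k =>
    key (truncation k u) (measurable_truncation hu k) (memLp_truncation hu k 2) (t / 3) s
      (by positivity) hs
  filter_upwards [hall] with x hx
  rw [show t / 3 + (t / 3 + t / 3) = t by ring] at hx
  have hfin : ∀ t : ℝ, 0 < t → heatAbs P t u x < ∞ := fun t ht =>
    (hP.heatAbs_le_lintegral ht hu x).trans_lt (ENNReal.mul_lt_top ENNReal.ofReal_lt_top hufin)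
  have hlim := ((hP.tendsto_heat_truncation hu (hfin t ht)).sub
    (hP.tendsto_heat_truncation hu (hfin (t + s) (add_pos ht hs)))).enorm
  -- `key` needs `u` in `L²`; its bound involves only the `L¹` norm, so it survives the limit of
  -- truncations.
  refine le_of_tendsto hlim (Eventually.of_forall fun k => (hx k).trans ?_)
  rw [← ENNReal.ofReal_mul (by positivity), ← ENNReal.ofReal_mul (by positivity)]
  refine mul_le_mul' (le_of_eq ?_) (lintegral_mono (enorm_truncation_le k u))
  congr 1
  rw [Real.div_rpow ht.le (by norm_num), Real.rpow_neg (by norm_num : (0 : ℝ) ≤ 3)]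
  field_simp

/-- The time regularity of the heat operator on weak `L^{n/α}`. -/
theorem exists_enorm_heat_sub_le (hS : IsBoundedAnalyticSemigroup θ S)
    (hK : HasGaussianKernel S P) (hP : GaussianBound P C A) {α : ℝ} (hα : 0 < α) (hαn : α < n) :
    ∃ K : ℝ, 0 < K ∧ ∀ (f : Rn n → ℂ) (N : ℝ), Measurable f → 0 < N →
      weakNorm (n / α) f ≤ ENNReal.ofReal N → ∀ t s : ℝ, 0 < t → 0 < s →
        ∀ᵐ x, ‖heat P t f x - heat P (t + s) f x‖ₑ ≤
          ENNReal.ofReal (K * (s / t) ^ (α / n) * t ^ (-(α / 2)) * N) := by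
  obtain ⟨K, hK0, hKu⟩ := exists_enorm_heat_sub_le_lintegral hS hK hP
  obtain ⟨K', hK0', hK'⟩ := hP.exists_heatAbs_le hα hαn
  have hC := hP.const_pos
  have hA := hP.rate_pos
  have hn : 0 < (n : ℝ) := hα.trans hαn
  have hp : 1 < n / α := by rwa [one_lt_div hα]
  have hp1 : 0 < n / α - 1 := by linarith
  refine ⟨2 * (C * (Real.pi / A) ^ ((n : ℝ) / 2)) + K * ((n / α) / (n / α - 1)), by positivity,
    fun f N hfm hN hf t s ht hs => ?_⟩
  -- Here `(N/l)^(n/α) = (s/t)⁻¹ t^(n/2)`, exactly the inverse of the `L¹ → L^∞` gain, so the large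
  -- part also contributes a multiple of `l`.
  set l : ℝ := (s / t) ^ (α / n) * t ^ (-(α / 2)) * N with hl
  have hl0 : 0 < l := by positivity
  set E : Set (Rn n) := {x | l < ‖f x‖} with hE
  have hEm : MeasurableSet E := measurableSet_lt measurable_const hfm.norm
  have h1 := lintegral_large_le hp hN hfm hf hl0
  have hm1 : Measurable (E.indicator f) := hfm.indicator hEm
  have hm2 : Measurable (Eᶜ.indicator f) := hfm.indicator hEm.compl
  have hsum : ∀ τ : ℝ, 0 < τ → ∀ x, heat P τ f x =
      heat P τ (E.indicator f) x + heat P τ (Eᶜ.indicator f) x := by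
    intro τ hτ x
    have hfin : heatAbs P τ f x < ∞ := (hK' f N hfm hN hf τ x hτ).trans_lt ENNReal.ofReal_lt_top
    unfold heat
    rw [← integral_add
      (hP.integrable_mul hm1 ((heatAbs_mono (fun y => enorm_indicator_le_enorm_self _ _)
        τ x).trans_lt hfin))
      (hP.integrable_mul hm2 ((heatAbs_mono (fun y => enorm_indicator_le_enorm_self _ _)
        τ x).trans_lt hfin))]
    refine integral_congr_ae (Eventually.of_forall fun y => ?_)
    simp only
    rw [← mul_add, ← Pi.add_apply (E.indicator f), indicator_self_add_compl]
  -- The bounded part needs no cancellation: its two heat operators are estimated separately, whence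
  -- the factor `2` in the constant.
  have hsmall : ∀ τ : ℝ, 0 < τ → ∀ x, ‖heat P τ (Eᶜ.indicator f) x‖ₑ ≤
      ENNReal.ofReal (C * (Real.pi / A) ^ ((n : ℝ) / 2) * l) := by
    intro τ hτ x
    refine (enorm_heat_le _ _ _).trans ?_
    rw [ENNReal.ofReal_mul (by positivity)]
    refine hP.lintegral_mul_const_le hτ (fun y => ?_) x
    by_cases hy : y ∈ E
    · rw [indicator_of_notMem (not_not_intro hy), enorm_zero]
      exact zero_le
    · rw [indicator_of_mem hy, ← ofReal_norm]
      exact ENNReal.ofReal_le_ofReal (not_lt.1 hy)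
  filter_upwards [hKu _ hm1 (h1.trans_lt ENNReal.ofReal_lt_top) t s ht hs] with x hx
  have hts : 0 < t + s := add_pos ht hs
  calc ‖heat P t f x - heat P (t + s) f x‖ₑ
      = ‖(heat P t (E.indicator f) x - heat P (t + s) (E.indicator f) x) +
          (heat P t (Eᶜ.indicator f) x - heat P (t + s) (Eᶜ.indicator f) x)‖ₑ := by
        rw [hsum t ht, hsum (t + s) hts]
        congr 1
        ring
    _ ≤ ENNReal.ofReal (K * (s / t) * t ^ (-((n : ℝ) / 2))) *
          ENNReal.ofReal (n / α / (n / α - 1) * l * (N / l) ^ (n / α)) +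
          (ENNReal.ofReal (C * (Real.pi / A) ^ ((n : ℝ) / 2) * l) +
            ENNReal.ofReal (C * (Real.pi / A) ^ ((n : ℝ) / 2) * l)) := by
        refine (enorm_add_le _ _).trans (add_le_add (hx.trans (by gcongr)) ?_)
        exact (enorm_sub_le).trans (add_le_add (hsmall t ht x) (hsmall _ hts x))
    _ = _ := by
        rw [← ENNReal.ofReal_mul (by positivity), ← ENNReal.ofReal_add (by positivity)
          (by positivity), ← ENNReal.ofReal_add (by positivity) (by positivity)]
        congr 1
        have e1 : N / l = (s / t) ^ (-(α / n)) * t ^ (α / 2) := by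
          rw [hl, Real.rpow_neg ht.le, Real.rpow_neg (by positivity)]
          field_simp
        have e2 : (N / l) ^ (n / α) = (s / t)⁻¹ * t ^ ((n : ℝ) / 2) := by
          rw [e1, Real.mul_rpow (by positivity) (by positivity), ← Real.rpow_mul (by positivity),
            ← Real.rpow_mul ht.le, ← Real.rpow_neg_one (s / t)]
          congr 2 <;> field_simp
        rw [e2, Real.rpow_neg ht.le ((n : ℝ) / 2),
          show (2 * (C * (Real.pi / A) ^ ((n : ℝ) / 2)) + K * ((n / α) / (n / α - 1))) *
            (s / t) ^ (α / n) * t ^ (-(α / 2)) * N =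
            (2 * (C * (Real.pi / A) ^ ((n : ℝ) / 2)) + K * ((n / α) / (n / α - 1))) * l by
              rw [hl]; ring]
        clear_value l
        field_simp
        ring

end Semigroup

/-! ### The difference operator on balls -/

theorem volume_ball_eq (c : Rn n) {r : ℝ} (hr : 0 < r) : volume (Metric.ball c r) =
    ENNReal.ofReal (r ^ (n : ℝ) * (volume (Metric.ball (0 : Rn n) 1)).toReal) := by
  rw [Measure.addHaar_ball_of_pos _ _ hr, ENNReal.ofReal_mul (by positivity),
    ENNReal.ofReal_toReal measure_ball_lt_top.ne, finrank_euclideanSpace_fin, Real.rpow_natCast]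

theorem toReal_volume_ball_pos : 0 < (volume (Metric.ball (0 : Rn n) 1)).toReal :=
  ENNReal.toReal_pos (Metric.measure_ball_pos _ _ one_pos).ne' measure_ball_lt_top.ne

section Difference

variable {θ : ℝ} {S : ℂ → L2 n →L[ℂ] L2 n} {P : ℝ → Rn n → Rn n → ℂ} {C A : ℝ}

theorem GaussianBound.stronglyMeasurable_diffIntegrand (hP : GaussianBound P C A)
    {f : Rn n → ℂ} (hf : Measurable f) (α s : ℝ) :
    StronglyMeasurable fun q : Rn n × ℝ => diffIntegrand P α s f q.1 q.2 := by
  have h := hP.stronglyMeasurable_heat hf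
  have h1 : Measurable fun q : Rn n × ℝ => heat P q.2 f q.1 :=
    h.measurable.comp (by fun_prop : Measurable fun q : Rn n × ℝ => (q.2, q.1))
  have h2 : Measurable fun q : Rn n × ℝ => heat P (q.2 + s) f q.1 :=
    h.measurable.comp (by fun_prop : Measurable fun q : Rn n × ℝ => (q.2 + s, q.1))
  have h3 : Measurable fun q : Rn n × ℝ => ((q.2 ^ (α / 2 - 1) : ℝ) : ℂ) :=
    Complex.measurable_ofReal.comp (measurable_snd.pow_const _)
  exact ((h1.sub h2).mul h3).stronglyMeasurable

theorem enorm_diffIntegrand {α s t : ℝ} (ht : 0 < t) (f : Rn n → ℂ) (x : Rn n) :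
    ‖diffIntegrand P α s f x t‖ₑ =
      ‖heat P t f x - heat P (t + s) f x‖ₑ * ENNReal.ofReal (t ^ (α / 2 - 1)) := by
  unfold diffIntegrand
  rw [enorm_mul]
  congr 1
  rw [← ofReal_norm, Complex.norm_real, Real.norm_of_nonneg (by positivity)]

/-- The integral over balls of the integrand of the difference operator. -/
theorem exists_lintegral_ball_diffIntegrand_le (hS : IsBoundedAnalyticSemigroup θ S)
    (hK : HasGaussianKernel S P) (hP : GaussianBound P C A) {α : ℝ} (hα : 0 < α) (hαn : α < n) :
    ∃ K : ℝ, 0 < K ∧ ∀ (f : Rn n → ℂ) (N : ℝ), Measurable f → 0 < N →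
      weakNorm (n / α) f ≤ ENNReal.ofReal N → ∀ (s : ℝ) (c : Rn n) (r : ℝ), 0 < s → 0 < r →
        ∫⁻ x in Metric.ball c r, ∫⁻ t in Ioi 0, ‖diffIntegrand P α s f x t‖ₑ ≤
          ENNReal.ofReal (K * (r ^ ((n : ℝ) - α) * s ^ (α / 2) + r ^ (n : ℝ)) * N) := by
  obtain ⟨K₁, hK₁0, hK₁⟩ := hP.exists_heatAbs_le hα hαn
  obtain ⟨K₂, hK₂0, hK₂⟩ := hP.exists_lintegral_ball_heatAbs_le hα hαn
  obtain ⟨K₃, hK₃0, hK₃⟩ := exists_enorm_heat_sub_le hS hK hP hα hαn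
  have hn : 0 < (n : ℝ) := hα.trans hαn
  set v := (volume (Metric.ball (0 : Rn n) 1)).toReal
  have hv : 0 < v := toReal_volume_ball_pos
  refine ⟨K₂ * (2 / α) + K₁ * v * (2 / α) + v * K₃ * (n / α), by positivity,
    fun f N hfm hN hf s c r hs hr => ?_⟩
  have hm := (hP.stronglyMeasurable_diffIntegrand hfm α s).measurable.enorm
  rw [lintegral_lintegral_swap hm.aemeasurable, ← Ioc_union_Ioi_eq_Ioi hs.le,
    lintegral_union measurableSet_Ioi (Ioc_disjoint_Ioi le_rfl)]
  have hinner : ∀ t : ℝ, 0 < t → ∫⁻ x in Metric.ball c r, ‖diffIntegrand P α s f x t‖ₑ =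
      (∫⁻ x in Metric.ball c r, ‖heat P t f x - heat P (t + s) f x‖ₑ) *
        ENNReal.ofReal (t ^ (α / 2 - 1)) := by
    intro t ht
    have hd : Measurable fun x => ‖heat P t f x - heat P (t + s) f x‖ₑ :=
      ((hP.measurable_heat_space hfm t).sub (hP.measurable_heat_space hfm (t + s))).enorm
    rw [← lintegral_mul_const _ hd]
    exact lintegral_congr fun x => enorm_diffIntegrand ht f x
  -- For `t ≤ s` the two terms are estimated apart: `e^{-tL} f` through its ball integral, as its
  -- sup bound would leave the non-integrable `t⁻¹`, and `e^{-(t+s)L} f` through the sup bound at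
  -- time `s`.
  have h1 : ∫⁻ t in Ioc 0 s, ∫⁻ x in Metric.ball c r, ‖diffIntegrand P α s f x t‖ₑ ≤
      ENNReal.ofReal ((K₂ * r ^ ((n : ℝ) - α) * N + K₁ * s ^ (-(α / 2)) * N * (r ^ (n : ℝ) * v)) *
        (s ^ (α / 2) / (α / 2))) := by
    calc _ ≤ ∫⁻ t in Ioc 0 s, ENNReal.ofReal (K₂ * r ^ ((n : ℝ) - α) * N +
            K₁ * s ^ (-(α / 2)) * N * (r ^ (n : ℝ) * v)) * ENNReal.ofReal (t ^ (α / 2 - 1)) := by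
          refine setLIntegral_mono (by fun_prop) fun t ht => ?_
          rw [hinner t ht.1]
          refine mul_le_mul_left ?_ _
          calc ∫⁻ x in Metric.ball c r, ‖heat P t f x - heat P (t + s) f x‖ₑ
              ≤ ∫⁻ x in Metric.ball c r, (heatAbs P t f x +
                  ENNReal.ofReal (K₁ * s ^ (-(α / 2)) * N)) := by
                refine lintegral_mono fun x => enorm_sub_le.trans
                  (add_le_add (enorm_heat_le _ _ _) ((enorm_heat_le _ _ _).trans ?_))
                refine (hK₁ f N hfm hN hf (t + s) x (add_pos ht.1 hs)).trans
                  (ENNReal.ofReal_le_ofReal ?_)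
                have : (t + s) ^ (-(α / 2)) ≤ s ^ (-(α / 2)) :=
                  Real.rpow_le_rpow_of_nonpos hs (by linarith [ht.1]) (by linarith)
                gcongr
            _ ≤ ENNReal.ofReal (K₂ * r ^ ((n : ℝ) - α) * N) +
                  ENNReal.ofReal (K₁ * s ^ (-(α / 2)) * N) *
                    ENNReal.ofReal (r ^ (n : ℝ) * v) := by
                rw [lintegral_add_right _ measurable_const, setLIntegral_const,
                  volume_ball_eq c hr]
                exact add_le_add (hK₂ f N hfm hN hf t c r ht.1 hr) le_rfl
            _ = _ := by
                rw [← ENNReal.ofReal_mul (by positivity),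
                  ← ENNReal.ofReal_add (by positivity) (by positivity)]
      _ = _ := by
          rw [lintegral_const_mul _ (by fun_prop), lintegral_Ioc_rpow (by linarith) hs,
            ← ENNReal.ofReal_mul (by positivity), sub_add_cancel]
  -- For `t > s` time regularity turns the integrand into `s^(α/n) t^(-α/n-1)`, whose integral is
  -- scale free.
  have h2 : ∫⁻ t in Ioi s, ∫⁻ x in Metric.ball c r, ‖diffIntegrand P α s f x t‖ₑ ≤
      ENNReal.ofReal (K₃ * s ^ (α / n) * N * (r ^ (n : ℝ) * v) *
        (s ^ (-(α / n)) / (α / n))) := by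
    calc _ ≤ ∫⁻ t in Ioi s, ENNReal.ofReal (K₃ * s ^ (α / n) * N * (r ^ (n : ℝ) * v)) *
            ENNReal.ofReal (t ^ (-(α / n) - 1)) := by
          refine setLIntegral_mono (by fun_prop) fun t ht => ?_
          have ht0 : 0 < t := hs.trans ht
          rw [hinner t ht0]
          calc (∫⁻ x in Metric.ball c r, ‖heat P t f x - heat P (t + s) f x‖ₑ) *
                ENNReal.ofReal (t ^ (α / 2 - 1))
              ≤ (∫⁻ _ in Metric.ball c r, ENNReal.ofReal
                  (K₃ * (s / t) ^ (α / n) * t ^ (-(α / 2)) * N)) *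
                    ENNReal.ofReal (t ^ (α / 2 - 1)) := by
                refine mul_le_mul_left (lintegral_mono_ae (ae_restrict_of_ae ?_)) _
                exact hK₃ f N hfm hN hf t s ht0 hs
            _ = _ := by
                rw [setLIntegral_const, volume_ball_eq c hr, ← ENNReal.ofReal_mul (by positivity),
                  ← ENNReal.ofReal_mul (by positivity), ← ENNReal.ofReal_mul (by positivity)]
                congr 1
                rw [Real.div_rpow hs.le ht0.le, Real.rpow_sub ht0, Real.rpow_sub ht0,
                  Real.rpow_neg ht0.le, Real.rpow_neg ht0.le]
                field_simp
                rfl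
      _ = _ := by
          have : 0 < α / n := by positivity
          rw [lintegral_const_mul _ (by fun_prop), lintegral_Ioi_rpow (by linarith) hs,
            ← ENNReal.ofReal_mul (by positivity), sub_add_cancel, neg_neg]
  refine (add_le_add h1 h2).trans ?_
  rw [← ENNReal.ofReal_add (by positivity) (by positivity)]
  refine ENNReal.ofReal_le_ofReal ?_
  rw [Real.rpow_neg hs.le, Real.rpow_neg hs.le]
  have e : (K₂ * r ^ ((n : ℝ) - α) * N + K₁ * (s ^ (α / 2))⁻¹ * N * (r ^ (n : ℝ) * v)) *
        (s ^ (α / 2) / (α / 2)) +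
      K₃ * s ^ (α / n) * N * (r ^ (n : ℝ) * v) * ((s ^ (α / n))⁻¹ / (α / n)) =
      (K₂ * (2 / α) * (r ^ ((n : ℝ) - α) * s ^ (α / 2)) +
        (K₁ * v * (2 / α) + v * K₃ * (n / α)) * r ^ (n : ℝ)) * N := by
    field_simp
    ring
  rw [e]
  refine mul_le_mul_of_nonneg_right ?_ hN.le
  -- The constant adds the coefficients of both powers; `p1` and `p2` are the resulting surplus.
  have p1 : 0 ≤ (K₁ * v * (2 / α) + v * K₃ * (n / α)) * (r ^ ((n : ℝ) - α) * s ^ (α / 2)) := by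
    positivity
  have p2 : 0 ≤ K₂ * (2 / α) * r ^ (n : ℝ) := by positivity
  linarith

theorem enorm_diffFracIntegral_le {α : ℝ} (hα : 0 < α) (s : ℝ) (f : Rn n → ℂ) (x : Rn n) :
    ‖diffFracIntegral P α s f x‖ₑ ≤ ENNReal.ofReal (Real.Gamma (α / 2))⁻¹ *
      ∫⁻ t in Ioi 0, ‖diffIntegrand P α s f x t‖ₑ := by
  have hΓ : 0 < Real.Gamma (α / 2) := Real.Gamma_pos_of_pos (by positivity)
  unfold diffFracIntegral
  rw [enorm_mul]
  refine mul_le_mul' (le_of_eq ?_) (enorm_integral_le_lintegral_enorm _)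
  rw [← ofReal_norm, Complex.norm_real, Real.norm_of_nonneg (by positivity)]

/-- The time integral of absolute values has finite integral over each ball, hence is finite almost
everywhere; countably many balls exhaust the space. -/
theorem ae_integrableOn_diffIntegrand (hS : IsBoundedAnalyticSemigroup θ S)
    (hK : HasGaussianKernel S P) (hP : GaussianBound P C A) {α : ℝ} (hα : 0 < α) (hαn : α < n)
    {f : Rn n → ℂ} {N : ℝ} (hfm : Measurable f) (hN : 0 < N)
    (hf : weakNorm (n / α) f ≤ ENNReal.ofReal N) {s : ℝ} (hs : 0 < s) :
    ∀ᵐ x, IntegrableOn (diffIntegrand P α s f x) (Ioi 0) := by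
  obtain ⟨K, -, hKb⟩ := exists_lintegral_ball_diffIntegrand_le hS hK hP hα hαn
  have hm := hP.stronglyMeasurable_diffIntegrand hfm α s
  have hmJ : Measurable fun x => ∫⁻ t in Ioi 0, ‖diffIntegrand P α s f x t‖ₑ :=
    hm.measurable.enorm.lintegral_prod_right'
  have h : ∀ k : ℕ, ∀ᵐ x, x ∈ Metric.ball (0 : Rn n) (k + 1) →
      ∫⁻ t in Ioi 0, ‖diffIntegrand P α s f x t‖ₑ < ∞ := by
    intro k
    rw [← ae_restrict_iff' measurableSet_ball]
    exact ae_lt_top hmJ ((hKb f N hfm hN hf s 0 (k + 1) hs (by positivity)).trans_lt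
      ENNReal.ofReal_lt_top).ne
  filter_upwards [ae_all_iff.2 h] with x hx
  obtain ⟨k, hk⟩ := exists_nat_ge ‖x‖
  refine ⟨(hm.comp_measurable (by fun_prop : Measurable fun t : ℝ => (x, t))).aestronglyMeasurable,
    hx k ?_⟩
  rw [mem_ball_zero_iff]
  linarith

/-- With `s = r²` the two terms of the ball estimate both equal `r^n`, and the division by the
volume removes the radius. -/
theorem exists_sharpMaximal_diffFracIntegral_le (hS : IsBoundedAnalyticSemigroup θ S)
    (hK : HasGaussianKernel S P) (hP : GaussianBound P C A) {α : ℝ} (hα : 0 < α) (hαn : α < n) :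
    ∃ K : ℝ, 0 < K ∧ ∀ (f : Rn n → ℂ) (N : ℝ), Measurable f → 0 < N →
      weakNorm (n / α) f ≤ ENNReal.ofReal N → ∀ x,
        sharpMaximal (fun s => diffFracIntegral P α s f) x ≤ ENNReal.ofReal (K * N) := by
  obtain ⟨K, hK0, hKb⟩ := exists_lintegral_ball_diffIntegrand_le hS hK hP hα hαn
  have hΓ : 0 < Real.Gamma (α / 2) := Real.Gamma_pos_of_pos (by positivity)
  set v := (volume (Metric.ball (0 : Rn n) 1)).toReal
  have hv : 0 < v := toReal_volume_ball_pos
  refine ⟨(Real.Gamma (α / 2))⁻¹ * (K * 2) / v, by positivity, fun f N hfm hN hf x => ?_⟩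
  have hmJ : ∀ s, Measurable fun x => ∫⁻ t in Ioi 0, ‖diffIntegrand P α s f x t‖ₑ := fun s =>
    (hP.stronglyMeasurable_diffIntegrand hfm α s).measurable.enorm.lintegral_prod_right'
  refine iSup_le fun c => iSup_le fun r => iSup_le fun hr => iSup_le fun _ => ?_
  rw [setLAverage_eq, volume_ball_eq c hr]
  calc (∫⁻ y in Metric.ball c r, ‖diffFracIntegral P α (r ^ 2) f y‖ₑ) /
        ENNReal.ofReal (r ^ (n : ℝ) * v)
      ≤ (ENNReal.ofReal (Real.Gamma (α / 2))⁻¹ * ENNReal.ofReal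
          (K * (r ^ ((n : ℝ) - α) * (r ^ 2) ^ (α / 2) + r ^ (n : ℝ)) * N)) /
        ENNReal.ofReal (r ^ (n : ℝ) * v) := by
        refine ENNReal.div_le_div_right ?_ _
        refine (lintegral_mono fun y => enorm_diffFracIntegral_le hα (r ^ 2) f y).trans ?_
        rw [lintegral_const_mul _ (hmJ _)]
        exact mul_le_mul_right (hKb f N hfm hN hf (r ^ 2) c r (by positivity) hr) _
    _ = _ := by
        rw [← ENNReal.ofReal_mul (by positivity), ← ENNReal.ofReal_div_of_pos (by positivity)]
        congr 1
        have e : r ^ ((n : ℝ) - α) * (r ^ 2) ^ (α / 2) = r ^ (n : ℝ) := by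
          rw [← Real.rpow_natCast r 2, ← Real.rpow_mul hr.le, ← Real.rpow_add hr]
          congr 1
          push_cast
          ring
        rw [e]
        field_simp
        ring

end Difference

/-! ### Local size of the potential, and the Riesz kernel -/

theorem sq_lintegral_mul_le {X : Type*} [MeasurableSpace X] {μ : Measure X}
    {f g : X → ℝ≥0∞} (hf : AEMeasurable f μ) (hg : AEMeasurable g μ) :
    (∫⁻ x, f x * g x ∂μ) ^ 2 ≤ (∫⁻ x, f x ^ 2 ∂μ) * ∫⁻ x, g x ^ 2 ∂μ := by
  refine (pow_le_pow_left₀ zero_le (lintegral_mul_le_sqrt_mul_sqrt hf hg) 2).trans (le_of_eq ?_)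
  rw [mul_pow, ← ENNReal.rpow_two, ← ENNReal.rpow_two, ← ENNReal.rpow_mul, ← ENNReal.rpow_mul]
  norm_num

/-- The substitution `t ↦ 1/t` turns this into the Gamma integral. -/
theorem lintegral_Ioi_rpow_mul_exp_neg_div {b B : ℝ} (hb : 0 < b) (hB : 0 < B) :
    ∫⁻ t in Ioi (0 : ℝ), ENNReal.ofReal (t ^ (-b - 1) * Real.exp (-(B / t))) =
      ENNReal.ofReal ((1 / B) ^ b * Real.Gamma b) := by
  have hG := Real.integral_rpow_mul_exp_neg_mul_Ioi hb hB
  have hcomp := integral_comp_rpow_Ioi (fun u : ℝ => u ^ (b - 1) * Real.exp (-(B * u)))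
    (p := -1) (by norm_num)
  have hcongr : ∀ t ∈ Ioi (0 : ℝ), (|(-1 : ℝ)| * t ^ ((-1 : ℝ) - 1)) •
      ((t ^ (-1 : ℝ)) ^ (b - 1) * Real.exp (-(B * t ^ (-1 : ℝ)))) =
      t ^ (-b - 1) * Real.exp (-(B / t)) := by
    intro t ht
    have ht0 : 0 < t := ht
    rw [abs_neg, abs_one, one_mul, smul_eq_mul, ← Real.rpow_mul ht0.le, ← mul_assoc,
      ← Real.rpow_add ht0, Real.rpow_neg_one, ← div_eq_mul_inv]
    congr 2
    ring
  rw [setIntegral_congr_fun measurableSet_Ioi hcongr, hG] at hcomp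
  have hpos : 0 < (1 / B) ^ b * Real.Gamma b := by
    have := Real.Gamma_pos_of_pos hb
    positivity
  have hint : IntegrableOn (fun t : ℝ => t ^ (-b - 1) * Real.exp (-(B / t))) (Ioi 0) := by
    by_contra h
    rw [integral_undef h] at hcomp
    exact hpos.ne hcomp
  rw [← ofReal_integral_eq_lintegral_ofReal hint, hcomp]
  filter_upwards [ae_restrict_mem measurableSet_Ioi] with t ht
  have ht0 : 0 < t := ht
  positivity

/-- The time integral of the Gaussian majorant is dominated by the Riesz kernel. -/
theorem exists_lintegral_gaussianMajorant_time_le {C A α : ℝ} (hC : 0 < C) (hA : 0 < A)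
    (hαn : α < n) : ∃ K : ℝ, 0 < K ∧ ∀ z : Rn n,
      ∫⁻ t in Ioi (0 : ℝ), gaussianMajorant C A t z * ENNReal.ofReal (t ^ (α / 2 - 1)) ≤
        ENNReal.ofReal K / ENNReal.ofReal (‖z‖ ^ ((n : ℝ) - α)) := by
  have hb : 0 < ((n : ℝ) - α) / 2 := by linarith
  have hΓ := Real.Gamma_pos_of_pos hb
  refine ⟨C * ((1 / A) ^ (((n : ℝ) - α) / 2) * Real.Gamma (((n : ℝ) - α) / 2)), by positivity,
    fun z => ?_⟩
  -- At `z = 0` the right side is `∞`, a positive number divided by `0`.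
  rcases eq_or_ne z 0 with rfl | hz
  · rw [norm_zero, Real.zero_rpow (by linarith), ENNReal.ofReal_zero, ENNReal.div_zero]
    · exact le_top
    · rw [Ne, ENNReal.ofReal_eq_zero, not_le]
      positivity
  · have hz' : 0 < ‖z‖ := norm_pos_iff.2 hz
    have e : ∀ t ∈ Ioi (0 : ℝ), gaussianMajorant C A t z * ENNReal.ofReal (t ^ (α / 2 - 1)) =
        ENNReal.ofReal C * ENNReal.ofReal (t ^ (-(((n : ℝ) - α) / 2) - 1) *
          Real.exp (-((A * ‖z‖ ^ 2) / t))) := by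
      intro t ht
      have ht0 : 0 < t := ht
      unfold gaussianMajorant
      rw [← ENNReal.ofReal_mul (by positivity), ← ENNReal.ofReal_mul (by positivity)]
      congr 1
      rw [show -(((n : ℝ) - α) / 2) - 1 = (α / 2 - 1) - (n : ℝ) / 2 by ring,
        Real.rpow_sub ht0 _ ((n : ℝ) / 2)]
      field_simp
    rw [setLIntegral_congr_fun measurableSet_Ioi e, lintegral_const_mul _ (by fun_prop),
      lintegral_Ioi_rpow_mul_exp_neg_div hb (by positivity), ← ENNReal.ofReal_mul (by positivity),
      ← ENNReal.ofReal_div_of_pos (by positivity)]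
    refine ENNReal.ofReal_le_ofReal (le_of_eq ?_)
    have e2 : (1 / (A * ‖z‖ ^ 2)) ^ (((n : ℝ) - α) / 2) =
        (1 / A) ^ (((n : ℝ) - α) / 2) / ‖z‖ ^ ((n : ℝ) - α) := by
      rw [show 1 / (A * ‖z‖ ^ 2) = (1 / A) / ‖z‖ ^ 2 by field_simp,
        Real.div_rpow (by positivity) (by positivity), ← Real.rpow_natCast ‖z‖ 2,
        ← Real.rpow_mul hz'.le]
      congr 2
      push_cast
      ring
    rw [e2]
    ring

section Potential

variable {P : ℝ → Rn n → Rn n → ℂ} {C A : ℝ}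

theorem GaussianBound.measurable_heatAbs_mul_rpow (hP : GaussianBound P C A) {f : Rn n → ℂ}
    (hf : Measurable f) (a : ℝ) :
    Measurable fun q : Rn n × ℝ => heatAbs P q.2 f q.1 * ENNReal.ofReal (q.2 ^ a) := by
  have h1 : Measurable fun q : Rn n × ℝ => heatAbs P q.2 f q.1 :=
    (hP.measurable_heatAbs hf).comp (by fun_prop : Measurable fun q : Rn n × ℝ => (q.2, q.1))
  exact h1.mul (measurable_snd.pow_const _).ennreal_ofReal

theorem GaussianBound.measurable_absFracIntegral (hP : GaussianBound P C A) {f : Rn n → ℂ}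
    (hf : Measurable f) (α : ℝ) : Measurable (absFracIntegral P α f) :=
  (hP.measurable_heatAbs_mul_rpow hf (α / 2 - 1)).lintegral_prod_right'.const_mul _

/-- The local `L²` bound of the part of the potential with small times. -/
theorem GaussianBound.exists_lintegral_ball_sq_le (hP : GaussianBound P C A) {α : ℝ}
    (hα : 0 < α) (hαn : α < n) :
    ∃ K : ℝ, 0 < K ∧ ∀ (f : Rn n → ℂ) (N : ℝ), Measurable f → 0 < N →
      weakNorm (n / α) f ≤ ENNReal.ofReal N → ∀ (c : Rn n) (r : ℝ), 0 < r →
        ∫⁻ x in Metric.ball c r,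
          (∫⁻ t in Ioc 0 (r ^ 2), heatAbs P t f x * ENNReal.ofReal (t ^ (α / 2 - 1))) ^ 2 ≤
          ENNReal.ofReal (K * r ^ (n : ℝ) * N ^ 2) := by
  obtain ⟨K₁, hK₁0, hK₁⟩ := hP.exists_heatAbs_le hα hαn
  obtain ⟨K₂, hK₂0, hK₂⟩ := hP.exists_lintegral_ball_heatAbs_le hα hαn
  refine ⟨K₁ * K₂ * (4 / α) ^ 2, by positivity, fun f N hfm hN hf c r hr => ?_⟩
  have hr2 : 0 < r ^ 2 := by positivity
  have hmt : ∀ x, Measurable fun t => heatAbs P t f x := fun x =>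
    (hP.measurable_heatAbs hfm).comp (by fun_prop : Measurable fun t : ℝ => (t, x))
  have hpow : ∀ a t : ℝ, 0 < t → ENNReal.ofReal (t ^ (a / 2)) ^ 2 = ENNReal.ofReal (t ^ a) := by
    intro a t ht
    rw [← ENNReal.ofReal_pow (by positivity), ← Real.rpow_natCast, ← Real.rpow_mul ht.le]
    congr 2
    push_cast
    ring
  have h1 : ∀ x, (∫⁻ t in Ioc 0 (r ^ 2), heatAbs P t f x * ENNReal.ofReal (t ^ (α / 2 - 1))) ^ 2 ≤
      ENNReal.ofReal ((r ^ 2) ^ (α / 4) / (α / 4)) *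
        ∫⁻ t in Ioc 0 (r ^ 2), heatAbs P t f x ^ 2 * ENNReal.ofReal (t ^ (3 * α / 4 - 1)) := by
    intro x
    -- Exponents for Cauchy–Schwarz: the first square is `t^(α/4-1)`, and the second, after one
    -- factor of the heat operator is bounded by `t^(-α/2)`, is again `t^(α/4-1)`. Both are
    -- integrable at `0`.
    have e1 : ∫⁻ t in Ioc 0 (r ^ 2), heatAbs P t f x * ENNReal.ofReal (t ^ (α / 2 - 1)) =
        ∫⁻ t in Ioc 0 (r ^ 2), ENNReal.ofReal (t ^ ((α / 4 - 1) / 2)) *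
          (heatAbs P t f x * ENNReal.ofReal (t ^ ((3 * α / 4 - 1) / 2))) := by
      refine setLIntegral_congr_fun measurableSet_Ioc fun t ht => ?_
      have ht0 : 0 < t := ht.1
      rw [mul_left_comm, ← ENNReal.ofReal_mul (by positivity), ← Real.rpow_add ht0]
      congr 3
      ring
    rw [e1]
    refine (sq_lintegral_mul_le (by fun_prop)
      ((hmt x).mul (by fun_prop)).aemeasurable).trans (le_of_eq ?_)
    congr 1
    · rw [setLIntegral_congr_fun measurableSet_Ioc
        (fun t ht => hpow (α / 4 - 1) t ht.1), lintegral_Ioc_rpow (by linarith) hr2,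
        sub_add_cancel]
    · refine setLIntegral_congr_fun measurableSet_Ioc fun t ht => ?_
      rw [Pi.mul_apply, mul_pow, hpow _ t ht.1]
  have hm2 : Measurable fun q : Rn n × ℝ =>
      heatAbs P q.2 f q.1 ^ 2 * ENNReal.ofReal (q.2 ^ (3 * α / 4 - 1)) := by
    have h1 : Measurable fun q : Rn n × ℝ => heatAbs P q.2 f q.1 :=
      (hP.measurable_heatAbs hfm).comp (by fun_prop : Measurable fun q : Rn n × ℝ => (q.2, q.1))
    exact (h1.pow_const 2).mul (measurable_snd.pow_const _).ennreal_ofReal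
  have h2 : ∫⁻ x in Metric.ball c r, ∫⁻ t in Ioc 0 (r ^ 2),
      heatAbs P t f x ^ 2 * ENNReal.ofReal (t ^ (3 * α / 4 - 1)) ≤
      ENNReal.ofReal (K₁ * K₂ * r ^ ((n : ℝ) - α) * N ^ 2 * ((r ^ 2) ^ (α / 4) / (α / 4))) := by
    rw [lintegral_lintegral_swap hm2.aemeasurable]
    calc _ ≤ ∫⁻ t in Ioc 0 (r ^ 2), ENNReal.ofReal (K₁ * K₂ * r ^ ((n : ℝ) - α) * N ^ 2) *
          ENNReal.ofReal (t ^ (α / 4 - 1)) := by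
          refine setLIntegral_mono (by fun_prop) fun t ht => ?_
          have ht0 : 0 < t := ht.1
          have hms := hP.measurable_heatAbs_space hfm t
          calc ∫⁻ x in Metric.ball c r,
                heatAbs P t f x ^ 2 * ENNReal.ofReal (t ^ (3 * α / 4 - 1))
              ≤ ∫⁻ x in Metric.ball c r, (ENNReal.ofReal (K₁ * t ^ (-(α / 2)) * N) *
                  heatAbs P t f x) * ENNReal.ofReal (t ^ (3 * α / 4 - 1)) := by
                refine lintegral_mono fun x => mul_le_mul_left ?_ _
                rw [sq]
                exact mul_le_mul_left (hK₁ f N hfm hN hf t x ht0) _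
            _ ≤ (ENNReal.ofReal (K₁ * t ^ (-(α / 2)) * N) *
                  ENNReal.ofReal (K₂ * r ^ ((n : ℝ) - α) * N)) *
                  ENNReal.ofReal (t ^ (3 * α / 4 - 1)) := by
                rw [lintegral_mul_const _ (hms.const_mul _), lintegral_const_mul _ hms]
                exact mul_le_mul_left (mul_le_mul_right (hK₂ f N hfm hN hf t c r ht0 hr) _) _
            _ = _ := by
                rw [← ENNReal.ofReal_mul (by positivity), ← ENNReal.ofReal_mul (by positivity),
                  ← ENNReal.ofReal_mul (by positivity)]
                congr 1
                rw [show α / 4 - 1 = -(α / 2) + (3 * α / 4 - 1) by ring, Real.rpow_add ht0]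
                ring
      _ = _ := by
          rw [lintegral_const_mul _ (by fun_prop), lintegral_Ioc_rpow (by linarith) hr2,
            ← ENNReal.ofReal_mul (by positivity), sub_add_cancel]
  refine (lintegral_mono h1).trans ?_
  have hm3 : Measurable fun x => ∫⁻ t in Ioc 0 (r ^ 2),
      heatAbs P t f x ^ 2 * ENNReal.ofReal (t ^ (3 * α / 4 - 1)) :=
    hm2.lintegral_prod_right'
  rw [lintegral_const_mul _ hm3]
  refine (mul_le_mul_right h2 _).trans (le_of_eq ?_)
  rw [← ENNReal.ofReal_mul (by positivity)]
  congr 1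
  have e : r ^ (n : ℝ) = r ^ ((n : ℝ) - α) * ((r ^ 2) ^ (α / 4) * (r ^ 2) ^ (α / 4)) := by
    rw [← Real.rpow_natCast r 2, ← Real.rpow_mul hr.le, ← Real.rpow_add hr, ← Real.rpow_add hr]
    congr 1
    push_cast
    ring
  rw [e]
  field_simp

/-- The part of the potential with large times is controlled by the Riesz potential at a
nearby point. -/
theorem GaussianBound.exists_lintegral_Ioi_heatAbs_le (hP : GaussianBound P C A) {α : ℝ}
    (hα : 0 < α) (hαn : α < n) :
    ∃ K : ℝ, 0 < K ∧ ∀ f : Rn n → ℂ, Measurable f → ∀ (x x₀ : Rn n) (r : ℝ), 0 < r →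
      ‖x - x₀‖ ≤ 2 * r →
        ∫⁻ t in Ioi (r ^ 2), heatAbs P t f x * ENNReal.ofReal (t ^ (α / 2 - 1)) ≤
          ENNReal.ofReal K * rieszPotential α (fun y => ‖f y‖ₑ) x₀ := by
  have hC := hP.const_pos
  have hA := hP.rate_pos
  have hn : 0 < (n : ℝ) := hα.trans hαn
  have hΓ₁ : 0 < Real.Gamma (α / 2) := Real.Gamma_pos_of_pos (by positivity)
  have hΓ₂ : 0 < Real.Gamma (((n : ℝ) - α) / 2) := Real.Gamma_pos_of_pos (by linarith)
  set γ : ℝ := Real.Gamma (((n : ℝ) - α) / 2) /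
      (2 ^ α * Real.pi ^ ((n : ℝ) / 2) * Real.Gamma (α / 2)) with hγ
  have hγ0 : 0 < γ := by positivity
  have hC' : 0 < C * Real.exp (4 * A) := by positivity
  obtain ⟨K, hK0, hK⟩ := exists_lintegral_gaussianMajorant_time_le (n := n) (α := α)
    (C := C * Real.exp (4 * A)) (A := A / 2) hC' (by positivity) hαn
  refine ⟨K / γ, by positivity, fun f hfm x x₀ r hr hx => ?_⟩
  have hg : Measurable fun q : ℝ × Rn n =>
      gaussianMajorant (C * Real.exp (4 * A)) (A / 2) q.1 q.2 := by
    unfold gaussianMajorant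
    fun_prop
  have hg2 : Measurable fun q : ℝ × Rn n =>
      gaussianMajorant (C * Real.exp (4 * A)) (A / 2) q.1 (x₀ - q.2) * ‖f q.2‖ₑ *
        ENNReal.ofReal (q.1 ^ (α / 2 - 1)) :=
    ((hg.comp (by fun_prop : Measurable fun q : ℝ × Rn n => (q.1, x₀ - q.2))).mul
      (hfm.comp measurable_snd).enorm).mul (measurable_fst.pow_const _).ennreal_ofReal
  -- As `‖x - x₀‖ ≤ 2r` and `r² < t`, one has `‖x₀ - y‖² ≤ 8t + 2‖x - y‖²`. Moving the centre thus
  -- costs half the rate and a factor `e^(4A)`.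
  have hshift : ∀ t ∈ Ioi (r ^ 2), ∀ y, ‖P t x y‖ₑ ≤
      gaussianMajorant (C * Real.exp (4 * A)) (A / 2) t (x₀ - y) := by
    intro t ht y
    have hrt : r ^ 2 < t := ht
    have ht0 : 0 < t := lt_trans (by positivity) hrt
    refine (hP.enorm_le ht0 x y).trans (ENNReal.ofReal_le_ofReal ?_)
    rw [show C * Real.exp (4 * A) / t ^ ((n : ℝ) / 2) *
      Real.exp (-(A / 2 * ‖x₀ - y‖ ^ 2 / t)) = C / t ^ ((n : ℝ) / 2) *
        (Real.exp (4 * A) * Real.exp (-(A / 2 * ‖x₀ - y‖ ^ 2 / t))) by ring, ← Real.exp_add]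
    refine mul_le_mul_of_nonneg_left (Real.exp_le_exp.2 ?_) (by positivity)
    have h3 : ‖x₀ - y‖ ≤ 2 * r + ‖x - y‖ := by
      calc ‖x₀ - y‖ = ‖(x₀ - x) + (x - y)‖ := by rw [sub_add_sub_cancel]
        _ ≤ ‖x₀ - x‖ + ‖x - y‖ := norm_add_le _ _
        _ ≤ _ := by rw [norm_sub_rev]; gcongr
    have h4 : ‖x₀ - y‖ ^ 2 ≤ 8 * t + 2 * ‖x - y‖ ^ 2 := by
      have h5 : ‖x₀ - y‖ ^ 2 ≤ (2 * r + ‖x - y‖) ^ 2 := by gcongr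
      nlinarith [sq_nonneg (2 * r - ‖x - y‖)]
    have h6 : A / 2 * ‖x₀ - y‖ ^ 2 / t ≤ 4 * A + A * ‖x - y‖ ^ 2 / t := by
      rw [div_le_iff₀ ht0, add_mul, div_mul_cancel₀ _ ht0.ne']
      nlinarith [mul_le_mul_of_nonneg_left h4 hA.le]
    linarith
  calc ∫⁻ t in Ioi (r ^ 2), heatAbs P t f x * ENNReal.ofReal (t ^ (α / 2 - 1))
      ≤ ∫⁻ t in Ioi (r ^ 2), ∫⁻ y, gaussianMajorant (C * Real.exp (4 * A)) (A / 2) t (x₀ - y) *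
          ‖f y‖ₑ * ENNReal.ofReal (t ^ (α / 2 - 1)) := by
        refine setLIntegral_mono hg2.lintegral_prod_right' fun t ht => ?_
        have hmt : Measurable fun y =>
            gaussianMajorant (C * Real.exp (4 * A)) (A / 2) t (x₀ - y) * ‖f y‖ₑ :=
          ((measurable_gaussianMajorant _ _ t).comp (measurable_const.sub measurable_id)).mul
            hfm.enorm
        rw [lintegral_mul_const _ hmt]
        exact mul_le_mul_left (lintegral_mono fun y => mul_le_mul_left (hshift t ht y) _) _
    _ ≤ ∫⁻ t in Ioi (0 : ℝ), ∫⁻ y,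
          gaussianMajorant (C * Real.exp (4 * A)) (A / 2) t (x₀ - y) *
          ‖f y‖ₑ * ENNReal.ofReal (t ^ (α / 2 - 1)) :=
        lintegral_mono_set (Ioi_subset_Ioi (by positivity))
    _ = ∫⁻ y, ∫⁻ t in Ioi (0 : ℝ),
          gaussianMajorant (C * Real.exp (4 * A)) (A / 2) t (x₀ - y) *
          ‖f y‖ₑ * ENNReal.ofReal (t ^ (α / 2 - 1)) :=
        lintegral_lintegral_swap hg2.aemeasurable
    _ ≤ ∫⁻ y, ENNReal.ofReal K * (‖f y‖ₑ / ENNReal.ofReal (‖x₀ - y‖ ^ ((n : ℝ) - α))) := by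
        refine lintegral_mono fun y => ?_
        have e : ∀ t : ℝ, gaussianMajorant (C * Real.exp (4 * A)) (A / 2) t (x₀ - y) *
            ‖f y‖ₑ * ENNReal.ofReal (t ^ (α / 2 - 1)) =
            ‖f y‖ₑ * (gaussianMajorant (C * Real.exp (4 * A)) (A / 2) t (x₀ - y) *
              ENNReal.ofReal (t ^ (α / 2 - 1))) := fun t => by ring
        simp_rw [e]
        have hmt : Measurable fun t : ℝ =>
            gaussianMajorant (C * Real.exp (4 * A)) (A / 2) t (x₀ - y) *
              ENNReal.ofReal (t ^ (α / 2 - 1)) :=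
          (hg.comp (by fun_prop : Measurable fun t : ℝ => (t, x₀ - y))).mul (by fun_prop)
        rw [lintegral_const_mul _ hmt]
        refine (mul_le_mul_right (hK (x₀ - y)) _).trans (le_of_eq ?_)
        rw [div_eq_mul_inv, div_eq_mul_inv]
        ring
    _ = _ := by
        have hmy : Measurable fun y => ‖f y‖ₑ / ENNReal.ofReal (‖x₀ - y‖ ^ ((n : ℝ) - α)) :=
          hfm.enorm.div (by fun_prop)
        rw [lintegral_const_mul _ hmy]
        unfold rieszPotential
        rw [← mul_assoc, ← ENNReal.ofReal_mul (by positivity), ← hγ, div_mul_cancel₀ _ hγ0.ne']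

end Potential

/-! ### Weighted norms -/

theorem typeNorm_lt_top_iff {ρ : ℝ} {F : Rn n → ℝ≥0∞} : typeNorm ρ F < ∞ ↔
    ∫⁻ x, F x ^ 2 / ENNReal.ofReal ((1 + ‖x‖) ^ ((n : ℝ) + ρ)) < ∞ :=
  ENNReal.rpow_lt_top_iff_of_pos (by norm_num)

/-- A function whose `L²` norms on balls grow like those of a constant is of type `2`. -/
theorem typeNorm_two_lt_top {F : Rn n → ℝ≥0∞} (hF : Measurable F) {R D : ℝ} (hR : 0 ≤ R)
    (hD : 0 ≤ D)
    (h : ∀ r : ℝ, R < r → ∫⁻ x in Metric.ball 0 r, F x ^ 2 ≤ ENNReal.ofReal (D * r ^ (n : ℝ))) :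
    typeNorm 2 F < ∞ := by
  rw [typeNorm_lt_top_iff]
  -- The weight is discretised by `⌊‖x‖⌋`; the offset `R + 1` makes the ball contain `x` and keeps
  -- its radius above `R`. The mass `(1+k)^n` against `(1+k)^(-n-2)` leaves a convergent sum.
  have hpt : ∀ x : Rn n, F x ^ 2 / ENNReal.ofReal ((1 + ‖x‖) ^ ((n : ℝ) + 2)) ≤
      ∑' k : ℕ, ENNReal.ofReal (((1 : ℝ) + k) ^ (-((n : ℝ) + 2))) *
        (Metric.ball (0 : Rn n) (R + 1 + k)).indicator (fun x => F x ^ 2) x := by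
    intro x
    refine le_trans ?_ (ENNReal.le_tsum ⌊‖x‖⌋₊)
    have h1 : (⌊‖x‖⌋₊ : ℝ) ≤ ‖x‖ := Nat.floor_le (norm_nonneg _)
    have h2 : ‖x‖ < ⌊‖x‖⌋₊ + 1 := Nat.lt_floor_add_one _
    rw [indicator_of_mem (by rw [mem_ball_zero_iff]; linarith), div_eq_mul_inv, mul_comm,
      ← ENNReal.ofReal_inv_of_pos (by positivity), ← Real.rpow_neg (by positivity)]
    refine mul_le_mul_left (ENNReal.ofReal_le_ofReal ?_) _
    exact Real.rpow_le_rpow_of_nonpos (by positivity) (by linarith)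
      (by have : (0 : ℝ) ≤ n := Nat.cast_nonneg n
          linarith)
  refine (lintegral_mono hpt).trans_lt ?_
  rw [lintegral_tsum fun k => (((hF.pow_const 2).indicator
    measurableSet_ball).const_mul _).aemeasurable]
  have hsum : Summable fun k : ℕ => D * (R + 1) ^ (n : ℝ) * (1 / ((k : ℝ) + 1) ^ 2) := by
    refine Summable.mul_left _ ?_
    have := (summable_nat_add_iff 1).2 (Real.summable_one_div_nat_pow.2 one_lt_two)
    simpa only [Nat.cast_add, Nat.cast_one] using this
  refine lt_of_le_of_lt (ENNReal.tsum_le_tsum fun k => ?_) hsum.tsum_ofReal_lt_top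
  rw [lintegral_const_mul _ ((hF.pow_const 2).indicator measurableSet_ball),
    lintegral_indicator measurableSet_ball]
  have hk0 : (0 : ℝ) ≤ k := Nat.cast_nonneg k
  refine (mul_le_mul_right (h (R + 1 + k) (by linarith)) _).trans ?_
  rw [← ENNReal.ofReal_mul (by positivity)]
  refine ENNReal.ofReal_le_ofReal ?_
  have h3 : (R + 1 + k) ^ (n : ℝ) ≤ (R + 1) ^ (n : ℝ) * ((1 : ℝ) + k) ^ (n : ℝ) := by
    rw [← Real.mul_rpow (by positivity) (by positivity)]
    refine Real.rpow_le_rpow (by positivity) ?_ (Nat.cast_nonneg n)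
    nlinarith
  have h4 : ((1 : ℝ) + k) ^ (-((n : ℝ) + 2)) * ((1 : ℝ) + k) ^ (n : ℝ) =
      1 / ((k : ℝ) + 1) ^ 2 := by
    rw [← Real.rpow_add (by positivity), show -((n : ℝ) + 2) + n = -(2 : ℕ) by push_cast; ring,
      Real.rpow_neg (by positivity), Real.rpow_natCast, one_div, add_comm]
  calc ((1 : ℝ) + k) ^ (-((n : ℝ) + 2)) * (D * (R + 1 + k) ^ (n : ℝ))
      ≤ ((1 : ℝ) + k) ^ (-((n : ℝ) + 2)) *
          (D * ((R + 1) ^ (n : ℝ) * ((1 : ℝ) + k) ^ (n : ℝ))) := by gcongr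
    _ = D * (R + 1) ^ (n : ℝ) *
          (((1 : ℝ) + k) ^ (-((n : ℝ) + 2)) * ((1 : ℝ) + k) ^ (n : ℝ)) := by ring
    _ = _ := by rw [h4]

theorem ENNReal.add_sq_le (a b : ℝ≥0∞) : (a + b) ^ 2 ≤ 2 * a ^ 2 + 2 * b ^ 2 := by
  have h := ENNReal.rpow_add_le_mul_rpow_add_rpow a b (p := 2) one_le_two
  rw [ENNReal.rpow_two, ENNReal.rpow_two, ENNReal.rpow_two] at h
  refine h.trans (le_of_eq ?_)
  norm_num
  ring

/-- If the Riesz potential is finite at one point, then the potential of absolute values is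
of type `2`. -/
theorem GaussianBound.typeNorm_absFracIntegral_lt_top {P : ℝ → Rn n → Rn n → ℂ} {C A : ℝ}
    (hP : GaussianBound P C A) {α : ℝ} (hα : 0 < α) (hαn : α < n) {f : Rn n → ℂ} {N : ℝ}
    (hfm : Measurable f) (hN : 0 < N) (hf : weakNorm (n / α) f ≤ ENNReal.ofReal N) {x₀ : Rn n}
    (hx₀ : rieszPotential α (fun y => ‖f y‖ₑ) x₀ < ∞) :
    typeNorm 2 (absFracIntegral P α f) < ∞ := by
  obtain ⟨K₁, hK₁0, hK₁⟩ := hP.exists_lintegral_ball_sq_le hα hαn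
  obtain ⟨K₂, hK₂0, hK₂⟩ := hP.exists_lintegral_Ioi_heatAbs_le hα hαn
  have hΓ : 0 < Real.Gamma (α / 2) := Real.Gamma_pos_of_pos (by positivity)
  set I := (rieszPotential α (fun y => ‖f y‖ₑ) x₀).toReal
  have hI : 0 ≤ I := ENNReal.toReal_nonneg
  set v := (volume (Metric.ball (0 : Rn n) 1)).toReal
  have hv : 0 < v := toReal_volume_ball_pos
  refine typeNorm_two_lt_top (R := ‖x₀‖) (D := (Real.Gamma (α / 2))⁻¹ ^ 2 *
    (2 * (K₁ * N ^ 2) + 2 * ((K₂ * I) ^ 2 * v)))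
    (hP.measurable_absFracIntegral hfm α) (norm_nonneg _) (by positivity) fun r hr => ?_
  have hr0 : 0 < r := (norm_nonneg _).trans_lt hr
  have hm := hP.measurable_heatAbs_mul_rpow hfm (α / 2 - 1)
  have hm1 : Measurable fun x => ∫⁻ t in Ioc 0 (r ^ 2),
      heatAbs P t f x * ENNReal.ofReal (t ^ (α / 2 - 1)) := hm.lintegral_prod_right'
  calc ∫⁻ x in Metric.ball 0 r, absFracIntegral P α f x ^ 2
      ≤ ∫⁻ x in Metric.ball 0 r, ENNReal.ofReal ((Real.Gamma (α / 2))⁻¹ ^ 2) *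
          (2 * (∫⁻ t in Ioc 0 (r ^ 2),
            heatAbs P t f x * ENNReal.ofReal (t ^ (α / 2 - 1))) ^ 2 +
            2 * ENNReal.ofReal ((K₂ * I) ^ 2)) := by
        refine setLIntegral_mono (((hm1.pow_const 2).const_mul _).add_const _ |>.const_mul _)
          fun x hx => ?_
        have hxr : ‖x‖ < r := mem_ball_zero_iff.1 hx
        -- Since `‖x₀‖ < r`, every `x` in the ball is within `2r` of `x₀`, so one value of the Riesz
        -- potential serves all radii.
        have h2 := hK₂ f hfm x x₀ r hr0 ((norm_sub_le _ _).trans (by linarith))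
        rw [← ENNReal.ofReal_toReal hx₀.ne, ← ENNReal.ofReal_mul hK₂0.le] at h2
        change (ENNReal.ofReal (Real.Gamma (α / 2))⁻¹ * ∫⁻ t in Ioi (0 : ℝ),
          heatAbs P t f x * ENNReal.ofReal (t ^ (α / 2 - 1))) ^ 2 ≤ _
        rw [mul_pow, ENNReal.ofReal_pow (by positivity), ENNReal.ofReal_pow (by positivity),
          ← Ioc_union_Ioi_eq_Ioi (sq_nonneg r),
          lintegral_union measurableSet_Ioi (Ioc_disjoint_Ioi le_rfl)]
        refine mul_le_mul_right ((ENNReal.add_sq_le _ _).trans ?_) _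
        gcongr
    _ ≤ ENNReal.ofReal ((Real.Gamma (α / 2))⁻¹ ^ 2) *
          (ENNReal.ofReal 2 * ENNReal.ofReal (K₁ * r ^ (n : ℝ) * N ^ 2) +
            ENNReal.ofReal 2 * ENNReal.ofReal ((K₂ * I) ^ 2) *
              ENNReal.ofReal (r ^ (n : ℝ) * v)) := by
        rw [lintegral_const_mul _ (((hm1.pow_const 2).const_mul _).add_const _),
          lintegral_add_right _ measurable_const, setLIntegral_const, volume_ball_eq 0 hr0,
          lintegral_const_mul _ (hm1.pow_const 2), ENNReal.ofReal_ofNat]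
        gcongr
        exact hK₁ f N hfm hN hf 0 r hr0
    _ = _ := by
        rw [← ENNReal.ofReal_mul (by norm_num), ← ENNReal.ofReal_mul (by norm_num),
          ← ENNReal.ofReal_mul (by positivity), ← ENNReal.ofReal_add (by positivity)
          (by positivity), ← ENNReal.ofReal_mul (by positivity)]
        congr 1
        ring

/-- A substitute for Cauchy–Schwarz against the weight: the constant `1` is integrable on balls and
against the kernel, the square is covered by the weighted norm. -/
theorem ENNReal.le_one_add_sq (a : ℝ≥0∞) : a ≤ 1 + a ^ 2 := by
  rcases le_total a 1 with h | h
  · exact h.trans le_self_add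
  · refine le_add_left ?_
    rw [sq]
    exact le_mul_of_one_le_left zero_le h

/-- By `1 + u ≤ e^u` the power becomes `e^(mu)`, and completing the square bounds `mu - au²`. -/
theorem one_add_rpow_mul_exp_neg_le {a m u : ℝ} (ha : 0 < a) (hm : 0 ≤ m) (hu : 0 ≤ u) :
    (1 + u) ^ m * Real.exp (-(a * u ^ 2)) ≤ Real.exp (m ^ 2 / (4 * a)) := by
  have h1 : (1 + u) ^ m ≤ Real.exp (m * u) := by
    rw [mul_comm, Real.exp_mul]
    exact Real.rpow_le_rpow (by positivity) (by linarith [Real.add_one_le_exp u]) hm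
  calc (1 + u) ^ m * Real.exp (-(a * u ^ 2))
      ≤ Real.exp (m * u) * Real.exp (-(a * u ^ 2)) := by gcongr
    _ = Real.exp (m * u - a * u ^ 2) := by rw [← Real.exp_add, sub_eq_add_neg]
    _ ≤ _ := by
        refine Real.exp_le_exp.2 ?_
        rw [le_div_iff₀ (by positivity)]
        nlinarith [sq_nonneg (m - 2 * a * u)]

theorem sharpMaximal_congr {D D' : ℝ → Rn n → ℂ} (h : ∀ s, 0 < s → D s =ᵐ[volume] D' s)
    (x : Rn n) : sharpMaximal D x = sharpMaximal D' x := by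
  unfold sharpMaximal
  congr! 6 with c r hr
  refine laverage_congr (ae_restrict_of_ae ?_)
  filter_upwards [h (r ^ 2) (by positivity)] with y hy
  rw [hy]

theorem enorm_fracIntegral_le {P : ℝ → Rn n → Rn n → ℂ} {α : ℝ} (hα : 0 < α) (f : Rn n → ℂ)
    (x : Rn n) : ‖fracIntegral P α f x‖ₑ ≤ absFracIntegral P α f x := by
  have hΓ : 0 < Real.Gamma (α / 2) := Real.Gamma_pos_of_pos (by positivity)
  unfold fracIntegral absFracIntegral
  rw [enorm_mul]
  refine mul_le_mul' (le_of_eq ?_) ((enorm_integral_le_lintegral_enorm _).trans ?_)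
  · rw [← ofReal_norm, Complex.norm_real, Real.norm_of_nonneg (by positivity)]
  · refine setLIntegral_mono' measurableSet_Ioi fun t ht => ?_
    have ht0 : 0 < t := ht
    rw [enorm_mul]
    refine mul_le_mul' (enorm_heat_le t f x) (le_of_eq ?_)
    rw [← ofReal_norm, Complex.norm_real, Real.norm_of_nonneg (by positivity)]

theorem lt_top_of_sq_div_lt_top {a w : ℝ≥0∞} (hw : w ≠ ∞) (h : a ^ 2 / w < ∞) : a < ∞ := by
  by_contra hc
  rw [not_lt, top_le_iff] at hc
  rw [hc, ENNReal.top_pow two_ne_zero, ENNReal.top_div_of_ne_top hw] at h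
  exact lt_irrefl _ h

theorem ae_lt_top_of_typeNorm_lt_top {ρ : ℝ} {F : Rn n → ℝ≥0∞} (hF : Measurable F)
    (h : typeNorm ρ F < ∞) : ∀ᵐ x, F x < ∞ := by
  rw [typeNorm_lt_top_iff] at h
  filter_upwards [ae_lt_top ((hF.pow_const 2).div (by fun_prop)) h.ne] with x hx
  exact lt_top_of_sq_div_lt_top ENNReal.ofReal_ne_top hx

/-- A weight comparison: `F ≤ 1 + w (F² / w)`. -/
theorem le_one_add_mul_sq_div (a : ℝ≥0∞) {w : ℝ} (hw : 0 < w) :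
    a ≤ 1 + ENNReal.ofReal w * (a ^ 2 / ENNReal.ofReal w) := by
  rw [ENNReal.mul_div_cancel (by simpa using hw) ENNReal.ofReal_ne_top]
  exact ENNReal.le_one_add_sq a

theorem locallyIntegrable_of_typeNorm_lt_top {ρ : ℝ} (hρ : 0 < ρ) {g : Rn n → ℂ}
    (hg : AEStronglyMeasurable g volume) (h : typeNorm ρ (fun x => ‖g x‖ₑ) < ∞) :
    LocallyIntegrable g volume := by
  rw [typeNorm_lt_top_iff] at h
  rw [locallyIntegrable_iff]
  intro k hk
  obtain ⟨R, hR⟩ := hk.isBounded.subset_ball 0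
  refine IntegrableOn.mono_set ?_ hR
  refine ⟨hg.restrict, ?_⟩
  have hn : (0 : ℝ) ≤ n := Nat.cast_nonneg n
  calc ∫⁻ x in Metric.ball 0 R, ‖g x‖ₑ
      ≤ ∫⁻ x in Metric.ball 0 R, (1 + ENNReal.ofReal ((1 + R) ^ ((n : ℝ) + ρ)) *
          (‖g x‖ₑ ^ 2 / ENNReal.ofReal ((1 + ‖x‖) ^ ((n : ℝ) + ρ)))) := by
        refine setLIntegral_mono' measurableSet_ball fun x hx => ?_
        have hx' : ‖x‖ < R := mem_ball_zero_iff.1 hx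
        refine (le_one_add_mul_sq_div _ (w := (1 + ‖x‖) ^ ((n : ℝ) + ρ)) (by positivity)).trans ?_
        gcongr
    _ = volume (Metric.ball (0 : Rn n) R) + ENNReal.ofReal ((1 + R) ^ ((n : ℝ) + ρ)) *
          ∫⁻ x in Metric.ball 0 R,
            ‖g x‖ₑ ^ 2 / ENNReal.ofReal ((1 + ‖x‖) ^ ((n : ℝ) + ρ)) := by
        rw [lintegral_add_left measurable_const, setLIntegral_const, one_mul,
          lintegral_const_mul' _ _ ENNReal.ofReal_ne_top]
    _ < ∞ := by
        refine ENNReal.add_lt_top.2 ⟨measure_ball_lt_top, ENNReal.mul_lt_top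
          ENNReal.ofReal_lt_top ((setLIntegral_le_lintegral _ _).trans_lt h)⟩

/-! ### Exchanging the semigroup with the time integral -/

section Identity

variable {θ : ℝ} {S : ℂ → L2 n →L[ℂ] L2 n} {P : ℝ → Rn n → Rn n → ℂ} {C A : ℝ}

/-- The heat operator converges absolutely on functions of `ρ`-type. -/
theorem GaussianBound.lintegral_mul_lt_top_of_typeNorm (hP : GaussianBound P C A) {ρ : ℝ}
    (hρ : 0 < ρ) {F : Rn n → ℝ≥0∞} (h : typeNorm ρ F < ∞) {s : ℝ} (hs : 0 < s) (x : Rn n) :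
    ∫⁻ y, ‖P s x y‖ₑ * F y < ∞ := by
  rw [typeNorm_lt_top_iff] at h
  have hC := hP.const_pos
  have hA := hP.rate_pos
  have hn : (0 : ℝ) ≤ n := Nat.cast_nonneg n
  set m : ℝ := (n : ℝ) + ρ with hm
  have hm0 : 0 ≤ m := by positivity
  set b : ℝ := C / s ^ ((n : ℝ) / 2) * ((1 + ‖x‖) ^ m * Real.exp (m ^ 2 / (4 * (A / s))))
  have hw : ∀ y, ‖P s x y‖ₑ * ENNReal.ofReal ((1 + ‖y‖) ^ m) ≤ ENNReal.ofReal b := by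
    intro y
    refine (mul_le_mul_left (hP.enorm_le hs x y) _).trans ?_
    unfold gaussianMajorant
    rw [← ENNReal.ofReal_mul (by positivity), mul_assoc]
    refine ENNReal.ofReal_le_ofReal (mul_le_mul_of_nonneg_left ?_ (by positivity))
    -- The weight at `y` is moved to `x` by `1 + ‖y‖ ≤ (1 + ‖x‖)(1 + ‖x - y‖)`; the Gaussian absorbs
    -- the second factor.
    have h1 : (1 + ‖y‖) ^ m ≤ (1 + ‖x‖) ^ m * (1 + ‖x - y‖) ^ m := by
      rw [← Real.mul_rpow (by positivity) (by positivity)]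
      refine Real.rpow_le_rpow (by positivity) ?_ hm0
      have h2 : ‖y‖ ≤ ‖x‖ + ‖x - y‖ := by
        calc ‖y‖ = ‖x - (x - y)‖ := by rw [sub_sub_cancel]
          _ ≤ _ := norm_sub_le _ _
      nlinarith [norm_nonneg x, norm_nonneg (x - y),
        mul_nonneg (norm_nonneg x) (norm_nonneg (x - y))]
    have h3 := one_add_rpow_mul_exp_neg_le (a := A / s) (by positivity) hm0 (norm_nonneg (x - y))
    rw [show A / s * ‖x - y‖ ^ 2 = A * ‖x - y‖ ^ 2 / s by ring] at h3
    calc Real.exp (-(A * ‖x - y‖ ^ 2 / s)) * (1 + ‖y‖) ^ m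
        ≤ Real.exp (-(A * ‖x - y‖ ^ 2 / s)) * ((1 + ‖x‖) ^ m * (1 + ‖x - y‖) ^ m) := by gcongr
      _ = (1 + ‖x‖) ^ m * ((1 + ‖x - y‖) ^ m * Real.exp (-(A * ‖x - y‖ ^ 2 / s))) := by ring
      _ ≤ _ := by gcongr
  have hPm := (hP.measurable_right s x).enorm
  calc ∫⁻ y, ‖P s x y‖ₑ * F y
      ≤ ∫⁻ y, (‖P s x y‖ₑ * 1 + ENNReal.ofReal b *
          (F y ^ 2 / ENNReal.ofReal ((1 + ‖y‖) ^ m))) := by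
        refine lintegral_mono fun y => ?_
        refine (mul_le_mul_right (le_one_add_mul_sq_div (F y) (w := (1 + ‖y‖) ^ m)
          (by positivity)) _).trans ?_
        rw [mul_add, ← mul_assoc]
        gcongr
        exact hw y
    _ < ∞ := by
        rw [lintegral_add_left (hPm.mul_const _), lintegral_const_mul' _ _ ENNReal.ofReal_ne_top]
        refine ENNReal.add_lt_top.2 ⟨?_, ENNReal.mul_lt_top ENNReal.ofReal_lt_top h⟩
        exact (hP.lintegral_mul_const_le hs (F := fun _ => 1) (b := 1) (fun _ => le_rfl)
          x).trans_lt (ENNReal.mul_lt_top ENNReal.ofReal_lt_top ENNReal.one_lt_top)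

theorem GaussianBound.stronglyMeasurable_heat_mul_rpow (hP : GaussianBound P C A) {f : Rn n → ℂ}
    (hf : Measurable f) (a : ℝ) :
    StronglyMeasurable fun q : Rn n × ℝ => heat P q.2 f q.1 * ((q.2 ^ a : ℝ) : ℂ) := by
  have h1 : Measurable fun q : Rn n × ℝ => heat P q.2 f q.1 :=
    (hP.stronglyMeasurable_heat hf).measurable.comp
      (by fun_prop : Measurable fun q : Rn n × ℝ => (q.2, q.1))
  exact (h1.mul (Complex.measurable_ofReal.comp (measurable_snd.pow_const _))).stronglyMeasurable

theorem GaussianBound.stronglyMeasurable_fracIntegral (hP : GaussianBound P C A) {f : Rn n → ℂ}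
    (hf : Measurable f) (α : ℝ) : StronglyMeasurable (fracIntegral P α f) :=
  (StronglyMeasurable.integral_prod_right (f := fun (x : Rn n) (t : ℝ) =>
    heat P t f x * ((t ^ (α / 2 - 1) : ℝ) : ℂ))
    (hP.stronglyMeasurable_heat_mul_rpow hf (α / 2 - 1))).const_mul _

/-- The semigroup law holds for each `t` off a null set depending on `t`; Fubini exchanges the
quantifiers, so that it can be used under the time integral at a fixed `x`. -/
theorem ae_ae_heat_heat (hS : IsBoundedAnalyticSemigroup θ S) (hK : HasGaussianKernel S P)
    (hP : GaussianBound P C A) {α : ℝ} (hα : 0 < α) (hαn : α < n) {f : Rn n → ℂ} {N : ℝ}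
    (hfm : Measurable f) (hN : 0 < N) (hf : weakNorm (n / α) f ≤ ENNReal.ofReal N)
    {s : ℝ} (hs : 0 < s) :
    ∀ᵐ x, ∀ᵐ t ∂(volume.restrict (Ioi (0 : ℝ))),
      heat P s (heat P t f) x = heat P (t + s) f x := by
  obtain ⟨K, -, hKb⟩ := hP.exists_heatAbs_le hα hαn
  have hm1 : StronglyMeasurable fun q : Rn n × ℝ => heat P s (heat P q.2 f) q.1 := by
    refine StronglyMeasurable.integral_prod_right (f := fun (q : Rn n × ℝ) (y : Rn n) =>
      P s q.1 y * heat P q.2 f y) ?_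
    have h1 : Measurable fun q : (Rn n × ℝ) × Rn n => P s q.1.1 q.2 := hP.measurable.comp
      (by fun_prop : Measurable fun q : (Rn n × ℝ) × Rn n => (s, q.1.1, q.2))
    have h2 : Measurable fun q : (Rn n × ℝ) × Rn n => heat P q.1.2 f q.2 :=
      (hP.stronglyMeasurable_heat hfm).measurable.comp
        (by fun_prop : Measurable fun q : (Rn n × ℝ) × Rn n => (q.1.2, q.2))
    exact (h1.mul h2).stronglyMeasurable
  have hm2 : Measurable fun q : Rn n × ℝ => heat P (q.2 + s) f q.1 :=
    (hP.stronglyMeasurable_heat hfm).measurable.comp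
      (by fun_prop : Measurable fun q : Rn n × ℝ => (q.2 + s, q.1))
  rw [Measure.ae_ae_comm (p := fun x t => heat P s (heat P t f) x = heat P (t + s) f x)
    (measurableSet_eq_fun hm1.measurable hm2)]
  filter_upwards [ae_restrict_mem measurableSet_Ioi] with t ht
  rw [add_comm t s]
  exact heat_heat_ae hS hK hP hs ht hfm fun τ hτ =>
    ⟨_, ENNReal.ofReal_lt_top, fun x => hKb f N hfm hN hf τ x hτ⟩

/-- The difference operator is `g - e^{-sL} g` for `g = L^{-α/2} f`. -/
theorem diffFracIntegral_ae_eq (hS : IsBoundedAnalyticSemigroup θ S) (hK : HasGaussianKernel S P)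
    (hP : GaussianBound P C A) {α : ℝ} (hα : 0 < α) (hαn : α < n) {f : Rn n → ℂ} {N : ℝ}
    (hfm : Measurable f) (hN : 0 < N) (hf : weakNorm (n / α) f ≤ ENNReal.ofReal N)
    {ρ : ℝ} (hρ : 0 < ρ) (hG : typeNorm ρ (absFracIntegral P α f) < ∞) {s : ℝ} (hs : 0 < s) :
    ∀ᵐ x, diffFracIntegral P α s f x =
      fracIntegral P α f x - heat P s (fracIntegral P α f) x := by
  have hΓ : 0 < Real.Gamma (α / 2) := Real.Gamma_pos_of_pos (by positivity)
  have hGm := hP.measurable_absFracIntegral hfm α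
  set J : Rn n → ℝ≥0∞ := fun x =>
    ∫⁻ t in Ioi (0 : ℝ), heatAbs P t f x * ENNReal.ofReal (t ^ (α / 2 - 1)) with hJ
  have hJG : ∀ x, J x = ENNReal.ofReal (Real.Gamma (α / 2)) * absFracIntegral P α f x := by
    intro x
    change J x = ENNReal.ofReal (Real.Gamma (α / 2)) *
      (ENNReal.ofReal (Real.Gamma (α / 2))⁻¹ * J x)
    rw [← mul_assoc, ← ENNReal.ofReal_mul hΓ.le, mul_inv_cancel₀ hΓ.ne', ENNReal.ofReal_one,
      one_mul]
  have hle : ∀ y, ∫⁻ t in Ioi (0 : ℝ), ‖heat P t f y * ((t ^ (α / 2 - 1) : ℝ) : ℂ)‖ₑ ≤ J y := by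
    intro y
    refine setLIntegral_mono' measurableSet_Ioi fun t ht => ?_
    have ht0 : 0 < t := ht
    rw [enorm_mul]
    refine mul_le_mul' (enorm_heat_le t f y) (le_of_eq ?_)
    rw [← ofReal_norm, Complex.norm_real, Real.norm_of_nonneg (by positivity)]
  have hsm := hP.stronglyMeasurable_heat_mul_rpow hfm (α / 2 - 1)
  filter_upwards [ae_lt_top_of_typeNorm_lt_top hGm hG,
    ae_ae_heat_heat hS hK hP hα hαn hfm hN hf hs] with x hx hsem
  have hint1 : IntegrableOn (fun t : ℝ => heat P t f x * ((t ^ (α / 2 - 1) : ℝ) : ℂ)) (Ioi 0) := by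
    refine ⟨(hsm.comp_measurable
      (by fun_prop : Measurable fun t : ℝ => (x, t))).aestronglyMeasurable,
      (hle x).trans_lt ?_⟩
    rw [hJG]
    exact ENNReal.mul_lt_top ENNReal.ofReal_lt_top hx
  -- Absolute convergence: the time integral of absolute values is at most a multiple of the
  -- potential, whose finite type makes it integrable against the kernel at time `s`.
  have hprod : Integrable (fun q : Rn n × ℝ =>
      P s x q.1 * (heat P q.2 f q.1 * ((q.2 ^ (α / 2 - 1) : ℝ) : ℂ)))
      ((volume : Measure (Rn n)).prod (volume.restrict (Ioi 0))) := by
    have hPm : Measurable fun q : Rn n × ℝ => P s x q.1 :=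
      (hP.measurable_right s x).comp measurable_fst
    have hmeas : Measurable fun q : Rn n × ℝ =>
        P s x q.1 * (heat P q.2 f q.1 * ((q.2 ^ (α / 2 - 1) : ℝ) : ℂ)) := hPm.mul hsm.measurable
    refine ⟨hmeas.aestronglyMeasurable, ?_⟩
    simp only [HasFiniteIntegral]
    rw [lintegral_prod _ hmeas.enorm.aemeasurable]
    refine lt_of_le_of_lt (lintegral_mono (g := fun y => ENNReal.ofReal (Real.Gamma (α / 2)) *
      (‖P s x y‖ₑ * absFracIntegral P α f y)) fun y => ?_) ?_
    · simp only [enorm_mul (P s x y)]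
      rw [lintegral_const_mul' _ _ enorm_ne_top]
      refine (mul_le_mul_right (hle y) _).trans (le_of_eq ?_)
      rw [hJG]
      ring
    · rw [lintegral_const_mul' _ _ ENNReal.ofReal_ne_top]
      exact ENNReal.mul_lt_top ENNReal.ofReal_lt_top
        (hP.lintegral_mul_lt_top_of_typeNorm hρ hG hs x)
  have hint_inner : ∀ᵐ t ∂(volume.restrict (Ioi (0 : ℝ))),
      ∫ y, P s x y * (heat P t f y * ((t ^ (α / 2 - 1) : ℝ) : ℂ)) =
        heat P (t + s) f x * ((t ^ (α / 2 - 1) : ℝ) : ℂ) := by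
    filter_upwards [hsem] with t ht
    rw [← ht]
    unfold heat
    rw [← integral_mul_const]
    simp only [mul_assoc]
  -- Integrability of the shifted integrand is a by-product of Fubini.
  have hint2 : IntegrableOn
      (fun t : ℝ => heat P (t + s) f x * ((t ^ (α / 2 - 1) : ℝ) : ℂ)) (Ioi 0) :=
    hprod.integral_prod_right.congr hint_inner
  have hheat : heat P s (fracIntegral P α f) x = ((Real.Gamma (α / 2))⁻¹ : ℝ) *
      ∫ t in Ioi (0 : ℝ), heat P (t + s) f x * ((t ^ (α / 2 - 1) : ℝ) : ℂ) := by
    rw [← integral_congr_ae hint_inner, ← integral_integral_swap hprod, ← integral_const_mul]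
    unfold heat fracIntegral
    refine integral_congr_ae (Eventually.of_forall fun y => ?_)
    simp only
    rw [integral_const_mul, mul_left_comm]
    rfl
  rw [hheat]
  unfold diffFracIntegral fracIntegral diffIntegrand
  rw [← mul_sub, ← integral_sub hint1 hint2]
  simp only [sub_mul]

end Identity

end Estimates

/-! ### Reduction to measurable functions and conclusion -/

/-- The estimates divide by `N` and so need `N > 0`, while the weak norm may vanish; letting `N`
decrease to it recovers the sharp form. -/
theorem le_mul_of_forall_ofReal_le {a W : ℝ≥0∞} {K : ℝ} (hK : 0 < K) (hW : W < ∞)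
    (h : ∀ N : ℝ, 0 < N → W ≤ ENNReal.ofReal N → a ≤ ENNReal.ofReal (K * N)) :
    a ≤ (K.toNNReal : ℝ≥0∞) * W := by
  refine ENNReal.le_of_forall_pos_le_add fun ε hε _ => ?_
  have hw : 0 ≤ W.toReal := ENNReal.toReal_nonneg
  have hε' : (0 : ℝ) < ε := hε
  have h1 := h (W.toReal + ε / K) (by positivity) (by
    rw [ENNReal.ofReal_add hw (by positivity), ENNReal.ofReal_toReal hW.ne]
    exact le_self_add)
  refine h1.trans (le_of_eq ?_)
  rw [mul_add, mul_div_cancel₀ _ hK.ne', ENNReal.ofReal_add (by positivity) hε'.le,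
    ENNReal.ofReal_mul hK.le, ENNReal.ofReal_toReal hW.ne, ENNReal.ofReal_coe_nnreal]
  rfl

theorem weakNorm_congr_ae {n : ℕ} {p : ℝ} {f g : Rn n → ℂ} (h : f =ᵐ[volume] g) :
    weakNorm p f = weakNorm p g := by
  unfold weakNorm
  refine iSup_congr fun l => ?_
  congr 2
  refine measure_congr ?_
  filter_upwards [h] with x hx
  change (_ < ‖f x‖ₑ) = (_ < ‖g x‖ₑ)
  rw [hx]

theorem absFracIntegral_congr_ae {n : ℕ} (P : ℝ → Rn n → Rn n → ℂ) (α : ℝ) {f g : Rn n → ℂ}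
    (h : f =ᵐ[volume] g) : absFracIntegral P α f = absFracIntegral P α g := by
  ext x
  unfold absFracIntegral
  congr 1
  refine lintegral_congr fun t => ?_
  congr 1
  refine lintegral_congr_ae ?_
  filter_upwards [h] with y hy
  rw [hy]

theorem rieszPotential_congr_ae {n : ℕ} (α : ℝ) {F G : Rn n → ℝ≥0∞} (h : F =ᵐ[volume] G) :
    rieszPotential α F = rieszPotential α G := by
  ext x
  unfold rieszPotential
  congr 1
  refine lintegral_congr_ae ?_
  filter_upwards [h] with y hy
  rw [hy]

theorem corollary3p3 {n : ℕ} {θ : ℝ} {L : L2 n →ₗ.[ℂ] L2 n} {S : ℂ → L2 n →L[ℂ] L2 n}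
    {P : ℝ → Rn n → Rn n → ℂ}
    (hS : IsBoundedAnalyticSemigroup θ S) (hL : IsGenerator L S) (hP : HasGaussianKernel S P)
    {α p : ℝ} (hα : 0 < α) (hαn : α < n) (hp : p = n / α) :
    ∃ C : ℝ≥0, 0 < C ∧ ∀ f : Rn n → ℂ, MemWeakLp p f →
      -- the bound for all of weak `L^p`, where `(I - e^{-sL}) L^{-α/2} f` always converges
      ((∀ s : ℝ, 0 < s → ∀ᵐ x, IntegrableOn (diffIntegrand P α s f x) (Ioi 0)) ∧
        essSup (sharpMaximal fun s => diffFracIntegral P α s f) volume ≤ C * weakNorm p f) ∧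
      -- the integral defining `L^{-α/2} f` converges if `I_α |f|` is finite
      ((∀ᵐ x, rieszPotential α (fun y => ‖f y‖ₑ) x < ∞) →
        ∃ ρ : ℝ, 0 < ρ ∧ typeNorm ρ (absFracIntegral P α f) < ∞) ∧
      -- whenever it converges, `L^{-α/2} f` is in `BMO_L`, with the bound
      ((∃ ρ : ℝ, 0 < ρ ∧ typeNorm ρ (absFracIntegral P α f) < ∞) →
        (∀ s : ℝ, 0 < s → ∀ᵐ x, diffFracIntegral P α s f x =
          fracIntegral P α f x - heat P s (fracIntegral P α f) x) ∧
        MemBMO P (fracIntegral P α f) ∧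
        bmoNorm P (fracIntegral P α f) ≤ C * weakNorm p f) := by
  subst hp
  obtain ⟨C, A, hPb⟩ := hP.exists_gaussianBound
  obtain ⟨K, hK0, hK⟩ := exists_sharpMaximal_diffFracIntegral_le hS hP hPb hα hαn
  refine ⟨K.toNNReal, by simpa using hK0, fun f₀ hf₀ => ?_⟩
  obtain ⟨hf₀m, hf₀w⟩ := hf₀
  -- Every object depends only on the class of `f`, and the heat operators agree at every point, so
  -- a measurable representative may be taken.
  obtain ⟨f, hfm, hff⟩ : ∃ f : Rn n → ℂ, Measurable f ∧ f₀ =ᵐ[volume] f :=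
    ⟨hf₀m.mk f₀, hf₀m.stronglyMeasurable_mk.measurable, hf₀m.ae_eq_mk⟩
  have hheat : ∀ t x, heat P t f₀ x = heat P t f x := fun t x => heat_congr_ae P hff t x
  have e1 : ∀ s, diffIntegrand P α s f₀ = diffIntegrand P α s f := fun s => by
    ext x t
    simp only [diffIntegrand, hheat]
  have e2 : ∀ s, diffFracIntegral P α s f₀ = diffFracIntegral P α s f := fun s => by
    ext x
    simp only [diffFracIntegral, e1]
  have e3 : fracIntegral P α f₀ = fracIntegral P α f := by
    ext x
    simp only [fracIntegral, hheat]
  have e4 : rieszPotential α (fun y => ‖f₀ y‖ₑ) = rieszPotential α (fun y => ‖f y‖ₑ) := by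
    refine rieszPotential_congr_ae α ?_
    filter_upwards [hff] with y hy
    rw [hy]
  simp only [e1, e2, e3, e4, absFracIntegral_congr_ae P α hff, weakNorm_congr_ae hff] at hf₀w ⊢
  set W := weakNorm (n / α) f with hW
  have hw : 0 ≤ W.toReal := ENNReal.toReal_nonneg
  have hN : 0 < W.toReal + 1 := by positivity
  have hfN : weakNorm (n / α) f ≤ ENNReal.ofReal (W.toReal + 1) := by
    rw [ENNReal.ofReal_add hw zero_le_one, ENNReal.ofReal_toReal hf₀w.ne]
    exact le_self_add
  have hbound : ∀ x, sharpMaximal (fun s => diffFracIntegral P α s f) x ≤ K.toNNReal * W :=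
    fun x => le_mul_of_forall_ofReal_le hK0 hf₀w fun N hN hfN => hK f N hfm hN hfN x
  refine ⟨⟨fun s hs => ae_integrableOn_diffIntegrand hS hP hPb hα hαn hfm hN hfN hs,
    essSup_le_of_ae_le _ (Eventually.of_forall hbound)⟩, fun hI => ?_, ?_⟩
  -- Finiteness of the Riesz potential at a single point is enough, and `ρ = 2` always works.
  · obtain ⟨x₀, hx₀⟩ := hI.exists
    exact ⟨2, two_pos, hPb.typeNorm_absFracIntegral_lt_top hα hαn hfm hN hfN hx₀⟩
  · rintro ⟨ρ, hρ, hG⟩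
    have hD : ∀ s : ℝ, 0 < s → ∀ᵐ x, diffFracIntegral P α s f x =
        fracIntegral P α f x - heat P s (fracIntegral P α f) x := fun s hs =>
      diffFracIntegral_ae_eq hS hP hPb hα hαn hfm hN hfN hρ hG hs
    have hbmo : bmoNorm P (fracIntegral P α f) ≤ K.toNNReal * W := by
      refine essSup_le_of_ae_le _ (Eventually.of_forall fun x => ?_)
      rw [← sharpMaximal_congr hD x]
      exact hbound x
    have htype : typeNorm ρ (fun x => ‖fracIntegral P α f x‖ₑ) < ∞ := by
      rw [typeNorm_lt_top_iff] at hG ⊢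
      refine (lintegral_mono fun x => ?_).trans_lt hG
      gcongr
      exact enorm_fracIntegral_le hα f x
    refine ⟨hD, ⟨⟨locallyIntegrable_of_typeNorm_lt_top hρ
      (hPb.stronglyMeasurable_fracIntegral hfm α).aestronglyMeasurable htype, ρ, hρ, htype⟩,
      hbmo.trans_lt (ENNReal.mul_lt_top ENNReal.coe_lt_top hf₀w)⟩, hbmo⟩
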